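/- Let $q(t)\in\mathbb{C}[t]$ be a polynomial of degree $n\ge 4$. Put $\rho=2q(-\tfrac12)$ and $$p(t)=\frac{-4q(t)q(-t-1)+\rho^2}{(1+2t)^2}\in\mathbb{C}[t],$$ and let $p_0,p_1\in\mathbb{C}[t]$ be the polynomials with $p(t)=p_0(t^2)+p_1(t^2)\,t$. Let $D(q)$ (the noncommutative type $D$ Kleinian singularity) be the associative unital $\mathbb{C}$-algebra with generators $u,v,w$ and defining relations $$[u,v]=2w+v,\qquad [u,w]=2vu+w+\rho,\qquad [v,w]=-v^2-p_1(u),\qquad w^2=v^2u+vw+\rho v+p_0(u).$$ Let $\hat W\cong\mathbb{Z}\rtimes S_2=\langle\delta,\tau\mid\tau\delta\tau^{-1}=\delta^{-1},\ \tau^2=1\rangle$ be the affine Weyl group of type $A_1^{(1)}$, acting on the field $\mathbb{C}(x)$ by $\mathbb{C}$-algebra automorphisms determined by $\delta(x)=x-1$, $\tau(x)=-x$. Let $\mathbb{C}(x)\#\hat W$ be the skew group algebra, i.e. the free left $\mathbb{C}(x)$-module on $\hat W$ with multiplication $(a\mu)(b\nu)=a\,\mu(b)\,\mu\nu$ for $a,b\in\mathbb{C}(x)$,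 $\mu,\nu\in\hat W$. In it consider the divided difference operators $$s_1=\frac{1}{2x}(1-\tau),\qquad s_0=\frac{1}{2x+1}(1-\delta^{-1}\tau),$$ and let $F(q)$ be the unital $\mathbb{C}$-subalgebra of $\mathbb{C}(x)\#\hat W$ generated by $q(x)s_0$, $s_1$ and $x$. Then $D(q)$ and $F(q)$ are Morita equivalent as $\mathbb{C}$-algebras, that is, their categories of modules are equivalent as $\mathbb{C}$-linear categories. -/

import Mathlib

namespace KleinianD

noncomputable section

open Polynomial

/-! ### The noncommutative type `D` Kleinian singularity -/

/-- The scalar `ρ = 2 q(-1/2)`. -/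
def rho (q : ℂ[X]) : ℂ := 2 * q.eval (-1 / 2)

/-- The polynomial `-4 q(t) q(-t-1) + ρ²`. -/
def pNum (q : ℂ[X]) : ℂ[X] := -4 * q * q.comp (-X - 1) + C (rho q ^ 2)

/-- The polynomial `p(t) = (-4 q(t) q(-t-1) + ρ²) / (1 + 2t)²`; the division is exact,
see `pPoly_mul`. -/
def pPoly (q : ℂ[X]) : ℂ[X] := pNum q / (1 + 2 * X) ^ 2

/-- The polynomial `p₀` in the decomposition `p(t) = p₀(t²) + p₁(t²) t`, i.e. the polynomial
whose `n`-th coefficient is the `2n`-th coefficient of `p`; see `pPoly_eq`. -/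
def pZero (q : ℂ[X]) : ℂ[X] := contract 2 (pPoly q)

/-- The polynomial `p₁` in the decomposition `p(t) = p₀(t²) + p₁(t²) t`, i.e. the polynomial
whose `n`-th coefficient is the `(2n+1)`-st coefficient of `p`; see `pPoly_eq`. -/
def pOne (q : ℂ[X]) : ℂ[X] := contract 2 (divX (pPoly q))

/-- The division defining `p` is exact. -/
theorem pPoly_mul (q : ℂ[X]) : pPoly q * (1 + 2 * X) ^ 2 = pNum q := by
  have h12 : (1 + 2 * X : ℂ[X]) = C 2 * (X - C (-1 / 2)) := by
    rw [mul_sub, ← C_mul, show (2 * (-1 / 2) : ℂ) = -1 by norm_num, C_neg, C_1,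
      show (C 2 : ℂ[X]) = 2 from rfl]
    ring
  have key : (1 + 2 * X : ℂ[X]) ^ 2 ∣ pNum q := by
    have hd : (X - C (-1 / 2) : ℂ[X]) ^ 2 ∣ pNum q := by
      by_cases h0 : pNum q = 0
      · rw [h0]; exact dvd_zero _
      rw [← le_rootMultiplicity_iff h0]
      refine (one_lt_rootMultiplicity_iff_isRoot h0).2 ⟨?_, ?_⟩
      · simp [pNum, IsRoot, rho, eval_comp]; norm_num; ring
      · rw [pNum, derivative_add, derivative_C, IsRoot]
        simp [eval_comp, derivative_comp]; norm_num; ring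
    rw [h12, mul_pow, ← C_pow]
    exact (IsUnit.mul_left_dvd (isUnit_C.2 (by norm_num))).2 hd
  rw [mul_comm]
  have hne : (1 + 2 * X : ℂ[X]) ^ 2 ≠ 0 := by
    rw [h12]
    exact pow_ne_zero _ (mul_ne_zero (C_ne_zero.2 two_ne_zero) (X_sub_C_ne_zero _))
  exact EuclideanDomain.mul_div_cancel' hne key

/-- The identity `p(t) = p₀(t²) + p₁(t²) t`. -/
theorem pPoly_eq (q : ℂ[X]) :
    pPoly q = (pZero q).comp (X ^ 2) + (pOne q).comp (X ^ 2) * X := by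
  rw [← expand_eq_comp_X_pow, ← expand_eq_comp_X_pow]
  ext n
  obtain ⟨k, rfl | rfl⟩ := Nat.even_or_odd' n
  · rcases k with _ | k
    · simp [coeff_expand, pZero, coeff_contract]
    · rw [show 2 * (k + 1) = 2 * k + 1 + 1 by ring, coeff_add, coeff_mul_X, coeff_expand two_pos,
        coeff_expand two_pos, if_pos (by omega), if_neg (by omega), pZero,
        coeff_contract two_ne_zero, add_zero]
      congr 1; omega
  · rw [coeff_add, coeff_mul_X, coeff_expand two_pos,
        coeff_expand two_pos, if_neg (by omega), if_pos (by omega), pOne,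
        coeff_contract two_ne_zero, zero_add, coeff_divX]
    congr 1; omega

/-- The three generators of `D(q)`. -/
inductive Gen
  | u
  | v
  | w

/-- The free generator `u`. -/
abbrev gu : FreeAlgebra ℂ Gen := FreeAlgebra.ι ℂ Gen.u

/-- The free generator `v`. -/
abbrev gv : FreeAlgebra ℂ Gen := FreeAlgebra.ι ℂ Gen.v

/-- The free generator `w`. -/
abbrev gw : FreeAlgebra ℂ Gen := FreeAlgebra.ι ℂ Gen.w

/-- The defining relations of `D(q)`:
`[u,v] = 2w + v`, `[u,w] = 2vu + w + ρ`, `[v,w] = -v² - p₁(u)`,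
`w² = v²u + vw + ρv + p₀(u)`. -/
inductive Rel (q : ℂ[X]) : FreeAlgebra ℂ Gen → FreeAlgebra ℂ Gen → Prop
  | uv : Rel q (gu * gv - gv * gu) (2 * gw + gv)
  | uw : Rel q (gu * gw - gw * gu) (2 * (gv * gu) + gw + algebraMap ℂ _ (rho q))
  | vw : Rel q (gv * gw - gw * gv) (-gv ^ 2 - aeval gu (pOne q))
  | ww : Rel q (gw ^ 2) (gv ^ 2 * gu + gv * gw + rho q • gv + aeval gu (pZero q))

/-- The noncommutative type `D` Kleinian singularity `D(q)`: the unital associative `ℂ`-algebra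
with generators `u, v, w` and the above relations. -/
abbrev D (q : ℂ[X]) : Type := RingQuot (Rel q)

/-! ### The affine Weyl group of type `A₁⁽¹⁾` and its action on `ℂ(x)` -/

/-- The action of `S₂ = {±1}` on the (multiplicatively written) group `ℤ`, by sign. -/
def signAut : ℤˣ →* MulAut (Multiplicative ℤ) where
  toFun e := AddEquiv.toMultiplicative (DistribMulAction.toAddEquiv ℤ e)
  map_one' := by ext; simp
  map_mul' a b := by
    ext n
    simp [MulAut.mul_apply, mul_smul, smul_comm a b]

/-- The affine Weyl group `Ŵ = ℤ ⋊ S₂` of type `A₁⁽¹⁾`, where `S₂ = {±1}` acts on `ℤ` by sign. -/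
abbrev AffineWeyl : Type := Multiplicative ℤ ⋊[signAut] ℤˣ

/-- The generator `δ` of the translation subgroup `ℤ`. -/
def delta : AffineWeyl := SemidirectProduct.inl (Multiplicative.ofAdd 1)

/-- The nontrivial element `τ` of `S₂`. -/
def tau : AffineWeyl := SemidirectProduct.inr (-1)

theorem tau_sq : tau ^ 2 = 1 := by
  rw [tau, ← map_pow]; simp

theorem tau_delta_tau_inv : tau * delta * tau⁻¹ = delta⁻¹ := by
  rw [tau, delta, ← map_inv, ← SemidirectProduct.inl_aut, ← map_inv]
  rfl

/-- The field automorphism of `ℂ(x)` with `f(x) ↦ f(x - 1)`. -/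
def shiftAut : RatFunc ℂ ≃ₐ[ℂ] RatFunc ℂ :=
  IsFractionRing.algEquivOfAlgEquiv (algEquivAevalXAddC (-1 : ℂ))

/-- The field automorphism of `ℂ(x)` with `f(x) ↦ f(-x)`. -/
def negAut : RatFunc ℂ ≃ₐ[ℂ] RatFunc ℂ :=
  IsFractionRing.algEquivOfAlgEquiv (algEquivAevalNegX (R := ℂ))

theorem shiftAut_X : shiftAut RatFunc.X = RatFunc.X - 1 := by
  rw [shiftAut, ← RatFunc.algebraMap_X, IsFractionRing.algEquivOfAlgEquiv_algebraMap]
  simp [sub_eq_add_neg]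

theorem negAut_X : negAut RatFunc.X = -RatFunc.X := by
  rw [negAut, ← RatFunc.algebraMap_X, IsFractionRing.algEquivOfAlgEquiv_algebraMap]
  simp

/-- An automorphism of `ℂ(x)` over `ℂ` is determined by its value at `x`. -/
theorem algEquiv_ext {f g : RatFunc ℂ ≃ₐ[ℂ] RatFunc ℂ} (h : f RatFunc.X = g RatFunc.X) :
    f = g := by
  have h1 : (f : RatFunc ℂ →ₐ[ℂ] RatFunc ℂ) = g := by
    apply IsLocalization.algHom_ext (nonZeroDivisors ℂ[X])
    apply Polynomial.algHom_ext
    rw [← RatFunc.algebraMap_X] at h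
    exact h
  exact AlgEquiv.ext fun x => DFunLike.congr_fun h1 x

theorem negAut_mul_self : negAut * negAut = 1 :=
  algEquiv_ext (by simp [AlgEquiv.mul_apply, negAut_X])

theorem negAut_shiftAut : negAut * shiftAut * negAut⁻¹ = shiftAut⁻¹ := by
  have h : negAut⁻¹ = negAut := inv_eq_of_mul_eq_one_left negAut_mul_self
  rw [h, eq_inv_iff_mul_eq_one]
  exact algEquiv_ext (by simp [AlgEquiv.mul_apply, negAut_X, shiftAut_X])

/-- The action of `S₂` on `ℂ(x)`: the nontrivial element negates `x`. -/
def signAct : ℤˣ →* (RatFunc ℂ ≃ₐ[ℂ] RatFunc ℂ) where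
  toFun e := if e = 1 then 1 else negAut
  map_one' := by simp
  map_mul' a b := by
    rcases Int.units_eq_one_or a with rfl | rfl <;>
      rcases Int.units_eq_one_or b with rfl | rfl <;> simp [negAut_mul_self]

/-- The action of `Ŵ` on `ℂ(x)` by `ℂ`-algebra automorphisms with `δ(x) = x - 1` and
`τ(x) = -x`. -/
def weylAct : AffineWeyl →* (RatFunc ℂ ≃ₐ[ℂ] RatFunc ℂ) :=
  SemidirectProduct.lift (zpowersHom _ shiftAut) signAct (by
    intro e
    ext1
    rcases Int.units_eq_one_or e with rfl | rfl
    · simp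
    · have h : signAut (-1) (Multiplicative.ofAdd 1) = (Multiplicative.ofAdd (1 : ℤ))⁻¹ := rfl
      have h2 : signAct (-1) = negAut := by simp [signAct]
      simp [h, h2, negAut_shiftAut])

instance : MulSemiringAction AffineWeyl (RatFunc ℂ) :=
  MulSemiringAction.compHom (RatFunc ℂ) weylAct

theorem smul_def (g : AffineWeyl) (f : RatFunc ℂ) : g • f = weylAct g f := rfl

instance : SMulCommClass AffineWeyl ℂ (RatFunc ℂ) where
  smul_comm g c f := by
    rw [smul_def, smul_def]
    exact (weylAct g).toLinearEquiv.map_smul c f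

theorem delta_smul_X : delta • (RatFunc.X : RatFunc ℂ) = RatFunc.X - 1 := by
  simp [smul_def, weylAct, delta, shiftAut_X]

theorem tau_smul_X : tau • (RatFunc.X : RatFunc ℂ) = -RatFunc.X := by
  simp [smul_def, weylAct, tau, signAct, negAut_X]

/-! ### The skew group algebra and the subalgebra `F(q)` -/

/-- The skew group algebra `ℂ(x) # Ŵ`: the free left `ℂ(x)`-module on `Ŵ` with
`(a g) (b h) = (a g(b)) (g h)`. -/
abbrev SkewAlg : Type := SkewMonoidAlgebra (RatFunc ℂ) AffineWeyl

/-- The embedding of rational functions `ℂ(x) → ℂ(x) # Ŵ`. -/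
def fn (f : RatFunc ℂ) : SkewAlg := SkewMonoidAlgebra.single 1 f

/-- The embedding of the group `Ŵ → ℂ(x) # Ŵ`. -/
def grp (g : AffineWeyl) : SkewAlg := SkewMonoidAlgebra.single g 1

theorem grp_mul_fn (g : AffineWeyl) (f : RatFunc ℂ) : grp g * fn f = fn (g • f) * grp g := by
  simp [grp, fn, SkewMonoidAlgebra.single_mul_single]

/-- The divided difference operator `s₁ = (1 / 2x) (1 - τ)`. -/
def s₁ : SkewAlg := fn (1 / (2 * RatFunc.X)) * (1 - grp tau)

/-- The divided difference operator `s₀ = (1 / (2x + 1)) (1 - δ⁻¹ τ)`. -/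
def s₀ : SkewAlg := fn (1 / (2 * RatFunc.X + 1)) * (1 - grp (delta⁻¹ * tau))

/-- The subalgebra `F(q)` of `ℂ(x) # Ŵ` generated by `q(x) s₀`, `s₁` and `x`. -/
def F (q : ℂ[X]) : Subalgebra ℂ SkewAlg :=
  Algebra.adjoin ℂ {fn (algebraMap ℂ[X] (RatFunc ℂ) q) * s₀, s₁, fn RatFunc.X}

end

end KleinianD

namespace KleinianD

noncomputable section

open Polynomial SkewMonoidAlgebra

/-! The algebra F(q) is in fact isomorphic to the 2 × 2 matrices over D(q). Let φ = `toSkew q` send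
u to x² and v, w to combinations of δ, 1, δ⁻¹ that commute with τ, and let e = (1 + τ)/2 be
`symIdem`; then e commutes with every φ(d). Each rational function is uniquely g + xh with g, h
even; correspondingly s₁xe = e, s₁e = 0, exe = 0 and e + xs₁ = 1. So the rows e, xe and the columns
e, s₁ give matrix units with corner e, and M ↦ Σ rᵢ φ(Mᵢⱼ) lⱼ is a homomorphism (`matrixHom`).

It is injective as soon as eφ(d) = 0 forces d = 0. Over ℂ[u], the powers of v and the elements vʲw
span D(q) (`exists_mem_filt`). The coefficients at δ⁻⁽ʲ⁺¹⁾ of eφ(vʲ⁺¹) and eφ(vʲw) are in the ratio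
1 : -(x + j + 1), while ℂ[u] acts by even polynomials, so parity separates them
(`eq_zero_of_mem_filt`).

Its range is F(q) (`range_matrixToSkew`): s₁ and x are visibly matrices, and `qs₀_mul_symIdem`
expresses q(x)s₀e through φ(v) and φ(w), a formula that can also be solved for φ(v)e and φ(w)e. -/

/-! ### Calculus in the skew group algebra -/

/-- The embedding `ℂ[x] → ℂ(x)`. -/
abbrev pol (P : ℂ[X]) : RatFunc ℂ := algebraMap ℂ[X] (RatFunc ℂ) P

theorem pol_X : pol X = RatFunc.X := RatFunc.algebraMap_X

theorem pol_ne_zero {P : ℂ[X]} (h : P ≠ 0) : pol P ≠ 0 :=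
  RatFunc.algebraMap_ne_zero h

theorem delta_smul_pol (P : ℂ[X]) : delta • pol P = pol (P.comp (X - 1)) := by
  rw [smul_def, show weylAct delta = shiftAut by simp [weylAct, delta], shiftAut,
    IsFractionRing.algEquivOfAlgEquiv_algebraMap]
  simp [algEquivAevalXAddC, aeval_def, comp, sub_eq_add_neg]

theorem tau_smul_pol (P : ℂ[X]) : tau • pol P = pol (P.comp (-X)) := by
  rw [smul_def, show weylAct tau = negAut by simp [weylAct, tau, signAct], negAut,
    IsFractionRing.algEquivOfAlgEquiv_algebraMap]
  simp [algEquivAevalNegX, aeval_def, comp]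

theorem delta_inv_smul_pol (P : ℂ[X]) : delta⁻¹ • pol P = pol (P.comp (X + 1)) := by
  rw [inv_smul_eq_iff, delta_smul_pol, comp_assoc]
  simp

theorem tau_mul_tau : tau * tau = 1 := by
  rw [← sq, tau_sq]

theorem tau_mul_delta : tau * delta = delta⁻¹ * tau := by
  rw [← tau_delta_tau_inv]; group

theorem tau_mul_delta_inv : tau * delta⁻¹ = delta * tau := by
  have h := congrArg (fun g => tau * g * tau) tau_mul_delta
  simp only [← mul_assoc, tau_mul_tau, one_mul] at h
  rw [mul_assoc _ tau tau, tau_mul_tau, mul_one] at h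
  exact h.symm

theorem smul_div_fn (g : AffineWeyl) (a b : RatFunc ℂ) : g • (a / b) = (g • a) / (g • b) := by
  simp only [smul_def, map_div₀]

theorem smul_two_fn (g : AffineWeyl) : g • (2 : RatFunc ℂ) = 2 := by
  rw [smul_def, map_ofNat]

theorem smul_four_fn (g : AffineWeyl) : g • (4 : RatFunc ℂ) = 4 := by
  rw [smul_def, map_ofNat]

theorem delta_inv_smul_X : delta⁻¹ • (RatFunc.X : RatFunc ℂ) = RatFunc.X + 1 := by
  rw [← pol_X, delta_inv_smul_pol]; simp

theorem smul_algebraMap_fn (g : AffineWeyl) (r : ℂ) :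
    g • (algebraMap ℂ (RatFunc ℂ) r) = algebraMap ℂ (RatFunc ℂ) r := by
  rw [smul_def, AlgEquiv.commutes]

/-- The embedding `ℂ(x) → ℂ(x) # Ŵ` as a homomorphism of algebras. -/
def fnHom : RatFunc ℂ →ₐ[ℂ] SkewAlg where
  toFun := fn
  map_one' := rfl
  map_mul' a b := by simp [fn, single_mul_single]
  map_zero' := single_zero 1
  map_add' a b := single_add 1 a b
  commutes' r := rfl

theorem fn_mul (a b : RatFunc ℂ) : fn (a * b) = fn a * fn b := map_mul fnHom a b
theorem fn_add (a b : RatFunc ℂ) : fn (a + b) = fn a + fn b := map_add fnHom a b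
theorem fn_one : fn 1 = 1 := map_one fnHom

theorem grp_mul (g h : AffineWeyl) : grp g * grp h = grp (g * h) := by
  simp [grp, single_mul_single]

theorem aeval_fn (P : ℂ[X]) : aeval (fn (RatFunc.X ^ 2)) P = fn (pol (P.comp (X ^ 2))) := by
  have h : aeval (fnHom (RatFunc.X ^ 2)) P = fnHom (aeval (RatFunc.X ^ 2) P) :=
    aeval_algHom_apply _ _ _
  refine h.trans (congrArg fn ?_)
  rw [← pol_X, ← map_pow, aeval_algebraMap_apply, aeval_def, comp]
  rfl

theorem C_mul_X_add_C_ne_zero {a : ℂ} (ha : a ≠ 0) (b : ℂ) : pol (C a * X + C b) ≠ 0 :=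
  pol_ne_zero fun h => ha (by simpa using congrArg (Polynomial.coeff · 1) h)

theorem X_ne : (RatFunc.X : RatFunc ℂ) ≠ 0 := RatFunc.X_ne_zero

theorem X_add_natCast_ne (n : ℕ) : (RatFunc.X : RatFunc ℂ) + n ≠ 0 := by
  simpa [pol, -RatFunc.algebraMap_C] using C_mul_X_add_C_ne_zero one_ne_zero (n : ℂ)

theorem X_sub_one_ne : (RatFunc.X : RatFunc ℂ) - 1 ≠ 0 := by
  simpa [pol, sub_eq_add_neg] using C_mul_X_add_C_ne_zero one_ne_zero (-1 : ℂ)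

theorem X_add_one_ne : (RatFunc.X : RatFunc ℂ) + 1 ≠ 0 := by
  simpa using X_add_natCast_ne 1

theorem two_X_add_intCast_ne (n : ℤ) : 2 * (RatFunc.X : RatFunc ℂ) + n ≠ 0 := by
  have h := C_mul_X_add_C_ne_zero two_ne_zero (n : ℂ)
  rwa [show (C (n : ℂ) : ℂ[X]) = n from map_intCast C n, show (C 2 : ℂ[X]) = 2 from rfl, pol,
    map_add, map_mul, map_intCast, map_ofNat, RatFunc.algebraMap_X] at h

theorem two_X_sub_one_ne : 2 * (RatFunc.X : RatFunc ℂ) - 1 ≠ 0 := by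
  simpa [sub_eq_add_neg] using two_X_add_intCast_ne (-1)

theorem two_X_add_one_ne : 2 * (RatFunc.X : RatFunc ℂ) + 1 ≠ 0 := by
  simpa using two_X_add_intCast_ne 1

theorem two_X_sub_three_ne : 2 * (RatFunc.X : RatFunc ℂ) - 3 ≠ 0 := by
  simpa [sub_eq_add_neg] using two_X_add_intCast_ne (-3)

theorem two_X_add_three_ne : 2 * (RatFunc.X : RatFunc ℂ) + 3 ≠ 0 := by
  simpa using two_X_add_intCast_ne 3

/-- The element `a δ² + b δ + c + d δ⁻¹ + e δ⁻²` of `ℂ(x) # Ŵ`. -/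
def laurent (a b c d e : RatFunc ℂ) : SkewAlg :=
  single (delta * delta) a + single delta b + single 1 c + single delta⁻¹ d +
    single (delta⁻¹ * delta⁻¹) e

theorem laurent_add (a b c d e a' b' c' d' e' : RatFunc ℂ) :
    laurent a b c d e + laurent a' b' c' d' e' =
      laurent (a + a') (b + b') (c + c') (d + d') (e + e') := by
  simp only [laurent, single_add]; abel

theorem laurent_neg (a b c d e : RatFunc ℂ) :
    -laurent a b c d e = laurent (-a) (-b) (-c) (-d) (-e) := by
  simp only [laurent, single_neg]; abel

theorem laurent_sub (a b c d e a' b' c' d' e' : RatFunc ℂ) :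
    laurent a b c d e - laurent a' b' c' d' e' =
      laurent (a - a') (b - b') (c - c') (d - d') (e - e') := by
  simp only [sub_eq_add_neg, laurent_neg, laurent_add]

theorem fn_eq_laurent (c : RatFunc ℂ) : fn c = laurent 0 0 c 0 0 := by
  simp [laurent, fn, single_zero]

theorem laurent_mul (b c d b' c' d' : RatFunc ℂ) :
    laurent 0 b c d 0 * laurent 0 b' c' d' 0 =
      laurent (b * delta • b') (b * delta • c' + c * b')
        (b * delta • d' + c * c' + d * delta⁻¹ • b') (c * d' + d * delta⁻¹ • c')
        (d * delta⁻¹ • d') := by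
  simp only [laurent, single_zero, zero_add, add_zero, mul_add, add_mul, single_mul_single,
    one_smul, mul_one, one_mul, mul_inv_cancel, inv_mul_cancel, single_add]
  abel

theorem fn_mul_laurent (r a b c d e : RatFunc ℂ) :
    fn r * laurent a b c d e = laurent (r * a) (r * b) (r * c) (r * d) (r * e) := by
  simp only [fn, laurent, mul_add, single_mul_single, one_smul, one_mul]

theorem smul_eq_fn_mul (r : ℂ) (a : SkewAlg) : r • a = fn (algebraMap ℂ _ r) * a :=
  Algebra.smul_def r a

theorem grp_tau_mul_laurent (b c d : RatFunc ℂ) :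
    grp tau * laurent 0 b c d 0 = laurent 0 (tau • d) (tau • c) (tau • b) 0 * grp tau := by
  simp only [grp, laurent, single_zero, zero_add, add_zero, mul_add, add_mul, single_mul_single,
    smul_one, mul_one, one_mul, tau_mul_delta, tau_mul_delta_inv]
  abel

/-! ### The representation of `D(q)` -/

/-- The coefficient of `δ` in the image of `v`. -/
def cPlus (q : ℂ[X]) : RatFunc ℂ := pol (q.comp (-X)) / (RatFunc.X * (2 * RatFunc.X - 1))

/-- The coefficient of `1` in the image of `v`. -/
def cZero (q : ℂ[X]) : RatFunc ℂ :=
  -2 * algebraMap ℂ _ (rho q) / ((2 * RatFunc.X - 1) * (2 * RatFunc.X + 1))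

/-- The coefficient of `δ⁻¹` in the image of `v`. -/
def cMinus (q : ℂ[X]) : RatFunc ℂ := pol q / (RatFunc.X * (2 * RatFunc.X + 1))

/-- The image of `v` in `ℂ(x) # Ŵ`. -/
def imV (q : ℂ[X]) : SkewAlg := laurent 0 (cPlus q) (cZero q) (cMinus q) 0

/-- The image of `w` in `ℂ(x) # Ŵ`. -/
def imW (q : ℂ[X]) : SkewAlg :=
  laurent 0 ((RatFunc.X - 1) * cPlus q) (-(cZero q) / 2) (-(RatFunc.X + 1) * cMinus q) 0

/-- The images of the generators of `D(q)` in `ℂ(x) # Ŵ`. -/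
def imGen (q : ℂ[X]) : Gen → SkewAlg
  | .u => fn (RatFunc.X ^ 2)
  | .v => imV q
  | .w => imW q

/-- The quadratic relations see q only through q(x)q(-x-1) and its image under τ. This is the
definition of p rearranged, and the only point where p₀ and p₁ are linked to q. -/
theorem four_mul_pol (q : ℂ[X]) :
    4 * (pol q * pol (q.comp (-X - 1))) = algebraMap ℂ _ (rho q) ^ 2 -
      (pol ((pZero q).comp (X ^ 2)) + pol ((pOne q).comp (X ^ 2)) * RatFunc.X) *
        (1 + 2 * RatFunc.X) ^ 2 := by
  have h := pPoly_mul q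
  rw [pPoly_eq, pNum] at h
  have h2 := congrArg pol h
  simp only [pol, map_mul, map_add, map_pow, map_neg, map_ofNat, map_one, RatFunc.algebraMap_X,
    RatFunc.algebraMap_C] at h2 ⊢
  have h3 : (algebraMap ℂ (RatFunc ℂ)) (rho q) = RatFunc.C (rho q) := rfl
  rw [h3, h2]; ring

theorem four_mul_pol_neg (q : ℂ[X]) :
    4 * (pol (q.comp (-X)) * pol (q.comp (X - 1))) = algebraMap ℂ _ (rho q) ^ 2 -
      (pol ((pZero q).comp (X ^ 2)) - pol ((pOne q).comp (X ^ 2)) * RatFunc.X) *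
        (1 - 2 * RatFunc.X) ^ 2 := by
  have h := congrArg (tau • ·) (four_mul_pol q)
  simp only [smul_mul', smul_add, smul_sub, smul_pow', tau_smul_pol, comp_assoc, tau_smul_X,
    smul_two_fn, smul_four_fn, smul_one, smul_algebraMap_fn] at h
  simp only [sub_comp, neg_comp, X_comp, one_comp, pow_comp, neg_neg, neg_sq] at h
  rw [h]; ring

theorem cPlus_mul_delta_smul_cMinus (q : ℂ[X]) :
    cPlus q * delta • cMinus q =
      (algebraMap ℂ _ (rho q) ^ 2 -
      (pol ((pZero q).comp (X ^ 2)) - pol ((pOne q).comp (X ^ 2)) * RatFunc.X) *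
        (1 - 2 * RatFunc.X) ^ 2) /
      (4 * RatFunc.X * (RatFunc.X - 1) * (2 * RatFunc.X - 1) ^ 2) := by
  rw [← four_mul_pol_neg, cPlus, cMinus]
  simp only [smul_div_fn, smul_mul', smul_add, delta_smul_pol, delta_smul_X, smul_two_fn,
    smul_one]
  have h1 := X_sub_one_ne
  have h2 := two_X_sub_one_ne
  have h3 := X_ne
  rw [show 2 * (RatFunc.X - 1 : RatFunc ℂ) + 1 = 2 * RatFunc.X - 1 by ring]
  field_simp

theorem cMinus_mul_delta_inv_smul_cPlus (q : ℂ[X]) :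
    cMinus q * delta⁻¹ • cPlus q =
      (algebraMap ℂ _ (rho q) ^ 2 -
      (pol ((pZero q).comp (X ^ 2)) + pol ((pOne q).comp (X ^ 2)) * RatFunc.X) *
        (1 + 2 * RatFunc.X) ^ 2) /
      (4 * RatFunc.X * (RatFunc.X + 1) * (2 * RatFunc.X + 1) ^ 2) := by
  rw [← four_mul_pol, cPlus, cMinus]
  simp only [smul_div_fn, smul_mul', smul_sub, delta_inv_smul_pol, delta_inv_smul_X, smul_two_fn,
    smul_one, comp_assoc, neg_comp, X_comp]
  have h1 := X_add_one_ne
  have h2 := two_X_add_one_ne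
  have h3 := X_ne
  rw [show 2 * (RatFunc.X + 1 : RatFunc ℂ) - 1 = 2 * RatFunc.X + 1 by ring,
    show (-(X + 1) : ℂ[X]) = -X - 1 by ring]
  field_simp

theorem delta_smul_cZero (q : ℂ[X]) : delta • cZero q =
    -2 * algebraMap ℂ _ (rho q) / ((2 * RatFunc.X - 3) * (2 * RatFunc.X - 1)) := by
  simp only [cZero, smul_div_fn, smul_mul', smul_sub, smul_add, smul_neg, delta_smul_X,
    smul_two_fn, smul_one, smul_algebraMap_fn]
  congr 1; ring

theorem delta_inv_smul_cZero (q : ℂ[X]) : delta⁻¹ • cZero q =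
    -2 * algebraMap ℂ _ (rho q) / ((2 * RatFunc.X + 1) * (2 * RatFunc.X + 3)) := by
  simp only [cZero, smul_div_fn, smul_mul', smul_sub, smul_add, smul_neg, delta_inv_smul_X,
    smul_two_fn, smul_one, smul_algebraMap_fn]
  congr 1; ring

theorem cZero_mul (q : ℂ[X]) :
    cZero q * ((2 * RatFunc.X - 1) * (2 * RatFunc.X + 1)) = -2 * algebraMap ℂ _ (rho q) :=
  div_mul_cancel₀ _ (mul_ne_zero two_X_sub_one_ne two_X_add_one_ne)

/-- The commutator with x² multiplies the coefficients of δ, 1, δ⁻¹ by 2x - 1, 0, -(2x + 1). This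
relation therefore forces the factors x - 1, -1/2, -(x + 1) in `imW`. -/
theorem imGen_uv (q : ℂ[X]) :
    fn (RatFunc.X ^ 2) * imV q - imV q * fn (RatFunc.X ^ 2) = 2 * imW q + imV q := by
  rw [two_mul, fn_eq_laurent, imV, imW]
  simp only [laurent_mul, laurent_sub, laurent_add, smul_pow', delta_smul_X, delta_inv_smul_X,
    smul_zero]
  congr 1 <;> ring

theorem imGen_uw (q : ℂ[X]) :
    fn (RatFunc.X ^ 2) * imW q - imW q * fn (RatFunc.X ^ 2) =
      2 * (imV q * fn (RatFunc.X ^ 2)) + imW q + fn (algebraMap ℂ _ (rho q)) := by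
  rw [two_mul, fn_eq_laurent, fn_eq_laurent, imV, imW]
  simp only [laurent_mul, laurent_sub, laurent_add, smul_pow', delta_smul_X, delta_inv_smul_X,
    smul_zero]
  congr 1
  · ring
  · ring
  -- The component at 1 reads (2x² - 1/2) `cZero q` + ρ = 0, which is what determines `cZero`.
  · have h := cZero_mul q
    linear_combination (-1 / 2) * h
  · ring
  · ring

theorem imGen_vw (q : ℂ[X]) :
    imV q * imW q - imW q * imV q =
      -imV q ^ 2 - fn (pol ((pOne q).comp (X ^ 2))) := by
  rw [sq, fn_eq_laurent, imV, imW]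
  simp only [laurent_mul, laurent_sub, laurent_neg, smul_mul', smul_sub, smul_add,
    smul_neg, smul_div_fn, smul_two_fn, smul_one, delta_smul_X, delta_inv_smul_X]
  have h1 := X_sub_one_ne
  have h2 := two_X_sub_one_ne
  have h3 := X_ne
  have h4 := X_add_one_ne
  have h5 := two_X_add_one_ne
  have h6 := two_X_sub_three_ne
  have h7 := two_X_add_three_ne
  congr 1
  · ring
  · rw [delta_smul_cZero, cZero]
    field_simp
    ring
  · have hp := cPlus_mul_delta_smul_cMinus q
    have hm := cMinus_mul_delta_inv_smul_cPlus q
    generalize delta • cMinus q = a at *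
    generalize delta⁻¹ • cPlus q = b at *
    -- Only the products of `cPlus q` with `a` and of `cMinus q` with `b` have known values, so both
    -- sides are first rewritten in terms of these products.
    have : ∀ x p m c s t : RatFunc ℂ, p * a = s → m * b = t →
      p * (-(x - 1 + 1) * a) + c * (-c / 2) + m * ((x + 1 - 1) * b) -
        ((x - 1) * p * a + -c / 2 * c + -(x + 1) * m * b) =
      (-2 * x + 1) * s + (2 * x + 1) * t := by
      rintro x p m c _ _ rfl rfl; ring
    rw [this _ _ _ _ _ _ hp hm]
    have : ∀ p m c s t r : RatFunc ℂ, p * a = s → m * b = t →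
      -(p * a + c * c + m * b) - r = -(s + c * c + t) - r := by
      rintro p m c _ _ r rfl rfl; ring
    rw [this _ _ _ _ _ _ hp hm, cZero]
    field_simp
    ring
  · rw [delta_inv_smul_cZero, cZero]
    field_simp
    ring
  · ring

theorem imGen_ww (q : ℂ[X]) :
    imW q ^ 2 = imV q ^ 2 * fn (RatFunc.X ^ 2) + imV q * imW q +
      fn (algebraMap ℂ _ (rho q)) * imV q + fn (pol ((pZero q).comp (X ^ 2))) := by
  -- `laurent_mul` needs factors without δ² and δ⁻² terms, hence the bracketing v(vx²).
  have hu : imV q ^ 2 * fn (RatFunc.X ^ 2) = imV q * (imV q * fn (RatFunc.X ^ 2)) := by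
    rw [sq, mul_assoc]
  rw [hu, sq, imV, imW]
  simp only [fn_eq_laurent, laurent_mul, laurent_add, smul_mul', smul_sub, smul_add, smul_neg, smul_div_fn,
    smul_two_fn, smul_one, delta_smul_X, delta_inv_smul_X, smul_zero, mul_zero, add_zero, zero_add,
    smul_pow', delta_smul_cZero, delta_inv_smul_cZero]
  have h1 := X_sub_one_ne
  have h2 := two_X_sub_one_ne
  have h3 := X_ne
  have h4 := X_add_one_ne
  have h5 := two_X_add_one_ne
  have h6 := two_X_sub_three_ne
  have h7 := two_X_add_three_ne
  have h0 : (4 : RatFunc ℂ) ≠ 0 := by norm_num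
  have h2' := mul_comm 2 (RatFunc.X : RatFunc ℂ) ▸ h2
  have h5' := mul_comm 2 (RatFunc.X : RatFunc ℂ) ▸ h5
  have h6' := mul_comm 2 (RatFunc.X : RatFunc ℂ) ▸ h6
  congr 1
  · ring
  · rw [cZero]
    field_simp
    ring
  · have hp := cPlus_mul_delta_smul_cMinus q
    have hm := cMinus_mul_delta_inv_smul_cPlus q
    generalize delta • cMinus q = a at *
    generalize delta⁻¹ • cPlus q = b at *
    have hc := cZero_mul q
    rw [eq_div_iff (mul_ne_zero (mul_ne_zero (mul_ne_zero h0 h3) h1)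
      (pow_ne_zero 2 h2))] at hp
    rw [eq_div_iff (mul_ne_zero (mul_ne_zero (mul_ne_zero h0 h3) h4)
      (pow_ne_zero 2 h5))] at hm
    apply mul_left_cancel₀ (pow_ne_zero 2 (mul_ne_zero h2 h5))
    -- With c = `cZero q`, P = `cPlus q * a` and M = `cMinus q * b`, the difference of the two sides
    -- is -2x(x-1)P - 2x(x+1)M + (3/4 - x²)c² - ρc; the multipliers are read off after scaling by
    -- (4x² - 1)².
    linear_combination (-1 / 2 * (2 * RatFunc.X + 1) ^ 2) * hp +
      (-1 / 2 * (2 * RatFunc.X - 1) ^ 2) * hm +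
      ((3 / 4 - RatFunc.X ^ 2) * (cZero q * ((2 * RatFunc.X - 1) * (2 * RatFunc.X + 1)) -
        2 * algebraMap ℂ _ (rho q)) - algebraMap ℂ _ (rho q) *
        ((2 * RatFunc.X - 1) * (2 * RatFunc.X + 1))) * hc
  · rw [cZero]
    field_simp
    ring
  · ring
-- The homomorphism from D(q) and the relations as rewriting rules
theorem lift_imGen_rel (q : ℂ[X]) ⦃a b : FreeAlgebra ℂ Gen⦄ (h : Rel q a b) :
    FreeAlgebra.lift ℂ (imGen q) a = FreeAlgebra.lift ℂ (imGen q) b := by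
  have hu : FreeAlgebra.lift ℂ (imGen q) gu = fn (RatFunc.X ^ 2) := FreeAlgebra.lift_ι_apply _ _
  have hv : FreeAlgebra.lift ℂ (imGen q) gv = imV q := FreeAlgebra.lift_ι_apply _ _
  have hw : FreeAlgebra.lift ℂ (imGen q) gw = imW q := FreeAlgebra.lift_ι_apply _ _
  have hr (P : ℂ[X]) : FreeAlgebra.lift ℂ (imGen q) (aeval gu P) =
      fn (pol (P.comp (X ^ 2))) := by
    rw [← aeval_algHom_apply, hu, aeval_fn]
  cases h with
  | uv =>
    simp only [map_sub, map_add, map_mul, map_ofNat, hu, hv, hw]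
    exact imGen_uv q
  | uw =>
    simp only [map_sub, map_add, map_mul, map_ofNat, hu, hv, hw, AlgHom.commutes]
    exact imGen_uw q
  | vw =>
    simp only [map_sub, map_neg, map_mul, map_pow, hv, hw, hr]
    exact imGen_vw q
  | ww =>
    simp only [map_add, map_mul, map_pow, map_smul, hu, hv, hw, hr, smul_eq_fn_mul]
    exact imGen_ww q

/-- The homomorphism `D(q) → ℂ(x) # Ŵ` with `u ↦ x²`. -/
def toSkew (q : ℂ[X]) : D q →ₐ[ℂ] SkewAlg :=
  RingQuot.liftAlgHom ℂ ⟨FreeAlgebra.lift ℂ (imGen q), lift_imGen_rel q⟩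

/-- The generators of `D(q)`. -/
def dGen (q : ℂ[X]) (g : Gen) : D q := RingQuot.mkAlgHom ℂ (Rel q) (FreeAlgebra.ι ℂ g)

theorem toSkew_dGen (q : ℂ[X]) (g : Gen) : toSkew q (dGen q g) = imGen q g := by
  rw [toSkew, dGen, RingQuot.liftAlgHom_mkAlgHom_apply, FreeAlgebra.lift_ι_apply]

theorem toSkew_aeval (q P : ℂ[X]) :
    toSkew q (aeval (dGen q .u) P) = fn (pol (P.comp (X ^ 2))) := by
  rw [← aeval_algHom_apply, toSkew_dGen, ← aeval_fn]; rfl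

theorem adjoin_dGen (q : ℂ[X]) : Algebra.adjoin ℂ (Set.range (dGen q)) = ⊤ := by
  have h := congrArg (Subalgebra.map (RingQuot.mkAlgHom ℂ (Rel q)))
    (FreeAlgebra.adjoin_range_ι ℂ Gen)
  rw [AlgHom.map_adjoin, ← Set.range_comp, Algebra.map_top,
    (AlgHom.range_eq_top _).2 (RingQuot.mkAlgHom_surjective ℂ (Rel q))] at h
  exact h

section Relations

variable (q : ℂ[X])

/-- The four relations are oriented towards a normal form with u on the left and at most one w, on
the far right. Terms such as vu survive on the right-hand sides; giving u degree 0 and v, w degree 1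
is what lets an induction absorb them. -/
theorem dGen_v_mul_u : dGen q .v * dGen q .u =
    dGen q .u * dGen q .v - 2 * dGen q .w - dGen q .v := by
  have h := RingQuot.mkAlgHom_rel ℂ (Rel.uv (q := q))
  simp only [map_sub, map_add, map_mul, map_ofNat] at h
  change dGen q .u * dGen q .v - dGen q .v * dGen q .u = 2 * dGen q .w + dGen q .v at h
  rw [sub_sub, ← h]; abel

theorem dGen_w_mul_u : dGen q .w * dGen q .u =
    dGen q .u * dGen q .w - 2 * (dGen q .v * dGen q .u) - dGen q .w -
      algebraMap ℂ _ (rho q) := by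
  have h := RingQuot.mkAlgHom_rel ℂ (Rel.uw (q := q))
  simp only [map_sub, map_add, map_mul, map_ofNat, AlgHom.commutes] at h
  change dGen q .u * dGen q .w - dGen q .w * dGen q .u =
    2 * (dGen q .v * dGen q .u) + dGen q .w + algebraMap ℂ _ (rho q) at h
  rw [sub_sub, sub_sub, ← add_assoc, ← h]; abel

theorem dGen_w_mul_v : dGen q .w * dGen q .v =
    dGen q .v * dGen q .w + dGen q .v * dGen q .v + aeval (dGen q .u) (pOne q) := by
  have h := RingQuot.mkAlgHom_rel ℂ (Rel.vw (q := q))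
  simp only [map_sub, map_neg, map_mul, map_pow, ← aeval_algHom_apply] at h
  change dGen q .v * dGen q .w - dGen q .w * dGen q .v =
    -dGen q .v ^ 2 - aeval (dGen q .u) (pOne q) at h
  rw [sub_eq_iff_eq_add] at h
  rw [h]; noncomm_ring

theorem dGen_w_mul_w : dGen q .w * dGen q .w =
    dGen q .v * dGen q .v * dGen q .u + dGen q .v * dGen q .w + rho q • dGen q .v +
      aeval (dGen q .u) (pZero q) := by
  have h := RingQuot.mkAlgHom_rel ℂ (Rel.ww (q := q))
  simp only [map_add, map_mul, map_pow, map_smul, ← aeval_algHom_apply] at h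
  rw [sq, sq] at h
  exact h

end Relations

/-! ### A spanning filtration of `D(q)` -/

/-- The subspace `ℂ[u] a` of `D(q)`. -/
def uSpan (q : ℂ[X]) (a : D q) : Submodule ℂ (D q) :=
  LinearMap.range (LinearMap.mulRight ℂ a ∘ₗ (aeval (dGen q .u)).toLinearMap)

theorem mem_uSpan {q : ℂ[X]} {a b : D q} :
    b ∈ uSpan q a ↔ ∃ P : ℂ[X], aeval (dGen q .u) P * a = b := Iff.rfl

/-- The span of `ℂ[u] v^i` with `i ≤ j` and `ℂ[u] v^i w` with `i < j`. -/
def filt (q : ℂ[X]) : ℕ → Submodule ℂ (D q)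
  | 0 => uSpan q 1
  | j + 1 => filt q j ⊔ uSpan q (dGen q .v ^ (j + 1)) ⊔ uSpan q (dGen q .v ^ j * dGen q .w)

variable {q : ℂ[X]}

theorem mem_filt_succ {j : ℕ} {d : D q} : d ∈ filt q (j + 1) ↔ ∃ d' ∈ filt q j, ∃ A B : ℂ[X],
    d = d' + aeval (dGen q .u) A * dGen q .v ^ (j + 1) +
      aeval (dGen q .u) B * (dGen q .v ^ j * dGen q .w) := by
  simp only [filt, Submodule.mem_sup, mem_uSpan]
  constructor
  · rintro ⟨_, ⟨d', hd', _, ⟨A, rfl⟩, rfl⟩, _, ⟨B, rfl⟩, rfl⟩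
    exact ⟨d', hd', A, B, rfl⟩
  · rintro ⟨d', hd', A, B, rfl⟩
    exact ⟨_, ⟨d', hd', _, ⟨A, rfl⟩, rfl⟩, _, ⟨B, rfl⟩, rfl⟩

theorem filt_le_succ (j : ℕ) : filt q j ≤ filt q (j + 1) :=
  le_sup_left.trans le_sup_left

theorem filt_mono : Monotone (filt q) := monotone_nat_of_le_succ filt_le_succ

theorem v_pow_mem_filt (j : ℕ) : dGen q .v ^ j ∈ filt q j := by
  cases j with
  | zero => exact ⟨1, by simp⟩
  | succ j => exact Submodule.mem_sup_left (Submodule.mem_sup_right ⟨1, by simp⟩)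

theorem v_pow_mul_w_mem_filt (j : ℕ) : dGen q .v ^ j * dGen q .w ∈ filt q (j + 1) :=
  Submodule.mem_sup_right ⟨1, by simp⟩

/-- Each `filt q j` is stable under left multiplication by `ℂ[u]`. -/
theorem aeval_mul_mem_filt (P : ℂ[X]) {j : ℕ} {d : D q} (hd : d ∈ filt q j) :
    aeval (dGen q .u) P * d ∈ filt q j := by
  have key (a d : D q) (h : d ∈ uSpan q a) : aeval (dGen q .u) P * d ∈ uSpan q a := by
    obtain ⟨Q, rfl⟩ := h
    exact ⟨P * Q, by simp [mul_assoc]⟩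
  induction j generalizing d with
  | zero => exact key _ _ hd
  | succ j ih =>
    obtain ⟨d', hd', A, B, rfl⟩ := mem_filt_succ.1 hd
    rw [mul_add, mul_add]
    exact mem_filt_succ.2 ⟨_, ih hd', P * A, P * B, by simp [mul_assoc]⟩

theorem u_mul_mem_filt {j : ℕ} {d : D q} (hd : d ∈ filt q j) : dGen q .u * d ∈ filt q j := by
  simpa using aeval_mul_mem_filt X hd

/-- To check that right multiplication by `a` maps `filt q j` to a subspace stable under `ℂ[u]`, it
suffices to check it on the monomials. -/
theorem mul_mem_filt_of_monomials (a : D q) {k : ℕ} :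
    ∀ {j : ℕ}, (∀ i ≤ j, dGen q .v ^ i * a ∈ filt q k) →
      (∀ i < j, dGen q .v ^ i * dGen q .w * a ∈ filt q k) →
      ∀ d ∈ filt q j, d * a ∈ filt q k
  | 0, h1, _, d, hd => by
    obtain ⟨P, rfl⟩ := mem_uSpan.1 hd
    simpa using aeval_mul_mem_filt P (h1 0 le_rfl)
  | j + 1, h1, h2, d, hd => by
    obtain ⟨d', hd', A, B, rfl⟩ := mem_filt_succ.1 hd
    rw [add_mul, add_mul, mul_assoc, mul_assoc (aeval _ B)]
    refine add_mem (add_mem (mul_mem_filt_of_monomials a (fun i hi => h1 i (hi.trans j.le_succ))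
      (fun i hi => h2 i (hi.trans j.lt_succ_self)) d' hd') ?_) ?_
    · exact aeval_mul_mem_filt A (h1 _ le_rfl)
    · exact aeval_mul_mem_filt B (h2 _ j.lt_succ_self)

theorem mul_aeval_mem_filt {j : ℕ} (hu : ∀ d ∈ filt q j, d * dGen q .u ∈ filt q j) (P : ℂ[X])
    {d : D q} (hd : d ∈ filt q j) : d * aeval (dGen q .u) P ∈ filt q j := by
  induction P using Polynomial.induction_on' with
  | add P Q hP hQ => rw [map_add, mul_add]; exact add_mem hP hQ
  | monomial n c =>
    rw [aeval_monomial, ← Algebra.smul_def, mul_smul_comm]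
    refine Submodule.smul_mem _ _ ?_
    induction n with
    | zero => simpa
    | succ n ih => rw [pow_succ, ← mul_assoc]; exact hu _ ih

theorem two_mul_mem_filt {j : ℕ} {d : D q} (hd : d ∈ filt q j) : 2 * d ∈ filt q j := by
  rw [two_mul]; exact add_mem hd hd

/-- If every `filt q i` with `i < j` is stable under right multiplication by `u`, then right
multiplication by `v` maps `filt q j` to `filt q (j + 1)`. -/
theorem mul_v_mem_filt {j : ℕ} (hu : ∀ i < j, ∀ d ∈ filt q i, d * dGen q .u ∈ filt q i)
    {d : D q} (hd : d ∈ filt q j) : d * dGen q .v ∈ filt q (j + 1) := by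
  refine mul_mem_filt_of_monomials _ (fun i hi => ?_) (fun i hi => ?_) d hd
  · rw [← pow_succ]; exact filt_mono (by omega) (v_pow_mem_filt (i + 1))
  · rw [mul_assoc, dGen_w_mul_v, mul_add, mul_add, ← mul_assoc, ← mul_assoc, ← pow_succ, ← pow_succ]
    refine add_mem (add_mem ?_ ?_) ?_
    · exact filt_mono (by omega) (v_pow_mul_w_mem_filt (i + 1))
    · exact filt_mono (by omega) (v_pow_mem_filt (i + 2))
    · exact filt_mono (by omega) (mul_aeval_mem_filt (hu i hi) (pOne q) (v_pow_mem_filt i))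

/-- In degree j + 1, vʲ⁺¹u = (vʲu)v - 2vʲw - vʲ⁺¹, and vʲu is covered by `hu`. -/
theorem v_pow_mul_u_mem_filt {j : ℕ} (hu : ∀ i < j, ∀ d ∈ filt q i, d * dGen q .u ∈ filt q i) :
    dGen q .v ^ j * dGen q .u ∈ filt q j := by
  cases j with
  | zero => simpa using u_mul_mem_filt (v_pow_mem_filt (q := q) 0)
  | succ j =>
    rw [pow_succ, mul_assoc, dGen_v_mul_u, mul_sub, mul_sub, ← mul_assoc, ← pow_succ,
      show dGen q .v ^ j * (2 * dGen q .w) = 2 * (dGen q .v ^ j * dGen q .w) by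
        rw [two_mul, two_mul, mul_add]]
    refine sub_mem (sub_mem ?_ (two_mul_mem_filt (v_pow_mul_w_mem_filt j))) (v_pow_mem_filt _)
    exact mul_v_mem_filt (fun i hi => hu i (by omega)) (hu j j.lt_succ_self _ (v_pow_mem_filt j))

/-- For i < j, rewriting vⁱww produces vⁱ⁺²u, which is why `hv` must reach j + 1. -/
theorem mul_w_mem_filt {j : ℕ} (hu : ∀ i < j, ∀ d ∈ filt q i, d * dGen q .u ∈ filt q i)
    (hv : ∀ i ≤ j + 1, dGen q .v ^ i * dGen q .u ∈ filt q i)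
    {d : D q} (hd : d ∈ filt q j) : d * dGen q .w ∈ filt q (j + 1) := by
  refine mul_mem_filt_of_monomials _ (fun i hi => ?_) (fun i hi => ?_) d hd
  · exact filt_mono (by omega) (v_pow_mul_w_mem_filt i)
  · rw [mul_assoc, dGen_w_mul_w, mul_add, mul_add, mul_add, ← mul_assoc, ← mul_assoc, ← mul_assoc,
      ← pow_succ, ← pow_succ, mul_smul_comm, ← pow_succ]
    refine add_mem (add_mem (add_mem ?_ ?_) ?_) ?_
    · exact filt_mono (by omega) (hv (i + 1 + 1) (by omega))
    · exact filt_mono (by omega) (v_pow_mul_w_mem_filt (i + 1))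
    · exact Submodule.smul_mem _ _ (filt_mono (by omega) (v_pow_mem_filt (i + 1)))
    · exact filt_mono (by omega) (mul_aeval_mem_filt (hu i hi) (pZero q) (v_pow_mem_filt i))

/-- Each `filt q j` is stable under right multiplication by `u`. -/
theorem mul_u_mem_filt (j : ℕ) : ∀ d ∈ filt q j, d * dGen q .u ∈ filt q j := by
  induction j using Nat.strong_induction_on with
  | _ j hu =>
    -- The monomials vⁱu are settled before vⁱwu, whose rewriting contains (vⁱu)w and vⁱ⁺¹u.
    have hv (i : ℕ) (hi : i ≤ j) : dGen q .v ^ i * dGen q .u ∈ filt q i :=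
      v_pow_mul_u_mem_filt fun k hk => hu k (hk.trans_le hi)
    refine mul_mem_filt_of_monomials _ (fun i hi => filt_mono hi (hv i hi)) (fun i hi => ?_)
    rw [mul_assoc, dGen_w_mul_u, mul_sub, mul_sub, mul_sub, ← mul_assoc,
      show dGen q .v ^ i * (2 * (dGen q .v * dGen q .u)) =
        2 * (dGen q .v ^ (i + 1) * dGen q .u) by
          rw [two_mul, two_mul, mul_add, ← mul_assoc, ← pow_succ],
      ← Algebra.commutes, ← Algebra.smul_def]
    refine sub_mem (sub_mem (sub_mem ?_ (two_mul_mem_filt ?_)) ?_) (Submodule.smul_mem _ _ ?_)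
    · exact filt_mono (by omega) (mul_w_mem_filt (fun k hk => hu k (hk.trans hi))
        (fun k hk => hv k (by omega)) (hv i hi.le))
    · exact filt_mono (by omega) (hv (i + 1) (by omega))
    · exact filt_mono (by omega) (v_pow_mul_w_mem_filt i)
    · exact filt_mono (by omega) (v_pow_mem_filt i)

/-- The filtration of `D(q)` is exhaustive. -/
theorem exists_mem_filt (d : D q) : ∃ j, d ∈ filt q j := by
  have hd : d ∈ Algebra.adjoin ℂ (Set.range (dGen q)) := adjoin_dGen q ▸ Algebra.mem_top
  -- Quantifying over a left factor makes the claim stable under products of d; a = 1 gives the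
  -- goal.
  suffices h : ∀ j, ∀ a ∈ filt q j, ∃ k, a * d ∈ filt q k by
    simpa using h 0 1 (by simpa using v_pow_mem_filt (q := q) 0)
  induction hd using Algebra.adjoin_induction with
  | mem x hx =>
    obtain ⟨g, rfl⟩ := hx
    intro j a ha
    cases g with
    | u => exact ⟨j, mul_u_mem_filt j a ha⟩
    | v => exact ⟨j + 1, mul_v_mem_filt (fun i _ => mul_u_mem_filt i) ha⟩
    | w => exact ⟨j + 1, mul_w_mem_filt (fun i _ => mul_u_mem_filt i)
        (fun i _ => mul_u_mem_filt i _ (v_pow_mem_filt i)) ha⟩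
  | algebraMap r =>
    intro j a ha
    exact ⟨j, by rw [← Algebra.commutes, ← Algebra.smul_def]; exact Submodule.smul_mem _ _ ha⟩
  | add x y _ _ hx hy =>
    intro j a ha
    obtain ⟨k, hk⟩ := hx j a ha
    obtain ⟨l, hl⟩ := hy j a ha
    exact ⟨max k l, by
      rw [mul_add]
      exact add_mem (filt_mono (le_max_left k l) hk) (filt_mono (le_max_right k l) hl)⟩
  | mul x y _ _ hx hy =>
    intro j a ha
    obtain ⟨k, hk⟩ := hx j a ha
    obtain ⟨l, hl⟩ := hy k _ hk
    exact ⟨l, by rwa [← mul_assoc]⟩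
/-! ### The symmetrizing idempotent -/

/-- The symmetrizing idempotent `(1 + τ) / 2`. -/
def symIdem : SkewAlg := (1 / 2 : ℂ) • (1 + grp tau)

theorem grp_tau_mul_grp_tau : grp tau * grp tau = 1 := by
  rw [grp_mul, tau_mul_tau]; rfl

theorem grp_tau_mul_symIdem : grp tau * symIdem = symIdem := by
  rw [symIdem, mul_smul_comm, mul_add, grp_tau_mul_grp_tau, mul_one, add_comm]

theorem symIdem_mul_symIdem : symIdem * symIdem = symIdem := by
  nth_rw 1 [symIdem]
  rw [smul_mul_assoc, add_mul, grp_tau_mul_symIdem, one_mul, ← two_smul ℂ, smul_smul]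
  norm_num

theorem symIdem_mul_of_commute {a : SkewAlg} (h : Commute (grp tau) a) :
    Commute symIdem a :=
  ((Commute.one_left a).add_left h).smul_left _

theorem commute_tau_fn {r : RatFunc ℂ} (h : tau • r = r) : Commute (grp tau) (fn r) := by
  rw [Commute, SemiconjBy, grp_mul_fn, h]

/-! ### Invariance of the image of D(q) under τ -/

variable (q : ℂ[X])

theorem tau_smul_cZero : tau • cZero q = cZero q := by
  simp only [cZero, smul_div_fn, smul_mul', smul_sub, smul_add, smul_neg, tau_smul_X,
    smul_two_fn, smul_one, smul_algebraMap_fn]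
  congr 1; ring

theorem tau_smul_cPlus : tau • cPlus q = cMinus q := by
  simp only [cPlus, cMinus, smul_div_fn, smul_mul', smul_sub, tau_smul_X,
    smul_two_fn, smul_one, tau_smul_pol, comp_assoc, neg_comp, X_comp, neg_neg, comp_X]
  congr 1; ring

theorem tau_smul_cMinus : tau • cMinus q = cPlus q := by
  rw [← tau_smul_cPlus, smul_smul, tau_mul_tau, one_smul]

/-- Conjugation by τ exchanges δ with δ⁻¹, and x ↦ -x exchanges the corresponding coefficients. -/
theorem commute_tau_imGen (g : Gen) : Commute (grp tau) (imGen q g) := by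
  cases g with
  | u => exact commute_tau_fn (by rw [smul_pow', tau_smul_X, neg_sq])
  | v =>
    change _ * imV q = imV q * _
    rw [imV, grp_tau_mul_laurent, tau_smul_cPlus, tau_smul_cMinus, tau_smul_cZero]
  | w =>
    change _ * imW q = imW q * _
    rw [imW, grp_tau_mul_laurent]
    simp only [smul_mul', smul_neg, smul_add, smul_sub, smul_div_fn, smul_one, smul_two_fn,
      tau_smul_X, tau_smul_cPlus, tau_smul_cMinus, tau_smul_cZero]
    rw [neg_add, neg_neg, sub_eq_add_neg, neg_add, sub_eq_add_neg]

theorem commute_symIdem_toSkew (d : D q) : Commute symIdem (toSkew q d) := by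
  have hd : d ∈ Algebra.adjoin ℂ (Set.range (dGen q)) := adjoin_dGen q ▸ Algebra.mem_top
  induction hd using Algebra.adjoin_induction with
  | mem x hx =>
    obtain ⟨g, rfl⟩ := hx
    rw [toSkew_dGen]
    exact symIdem_mul_of_commute (commute_tau_imGen q g)
  | algebraMap r => rw [AlgHom.commutes]; exact (Algebra.commutes r _).symm
  | add x y _ _ hx hy => rw [map_add]; exact hx.add_right hy
  | mul x y _ _ hx hy => rw [map_mul]; exact hx.mul_right hy

/-! ### Leading coefficients -/

theorem delta_inv_pow_left (j : ℕ) :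
    (delta⁻¹ ^ j : AffineWeyl).left = Multiplicative.ofAdd (-(j : ℤ)) := by
  rw [delta, ← map_inv, ← map_pow, SemidirectProduct.left_inl, ← ofAdd_neg, ← ofAdd_nsmul]
  simp

theorem delta_inv_pow_right (j : ℕ) : (delta⁻¹ ^ j : AffineWeyl).right = 1 := by
  rw [delta, ← map_inv, ← map_pow, SemidirectProduct.right_inl]

theorem coeff_symIdem (j : ℕ) :
    symIdem.coeff (delta⁻¹ ^ j) = if j = 0 then 1 / 2 else 0 := by
  classical
  have h1 : tau ≠ delta⁻¹ ^ j := fun h => by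
    have := congrArg SemidirectProduct.right h
    rw [delta_inv_pow_right] at this
    exact absurd this (by decide)
  have h2 : (1 : AffineWeyl) = delta⁻¹ ^ j ↔ j = 0 := by
    refine ⟨fun h => ?_, fun h => by rw [h, pow_zero]⟩
    have := congrArg SemidirectProduct.left h
    rw [delta_inv_pow_left] at this
    have h0 := congrArg Multiplicative.toAdd this
    simpa using h0
  rw [symIdem, SkewMonoidAlgebra.coeff_smul, SkewMonoidAlgebra.coeff_add, one_def, grp]
  simp only [coeff_single, Finsupp.smul_apply, Finsupp.add_apply, Finsupp.single_apply, h1, h2,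
    if_false, add_zero]
  split_ifs
  · rw [Algebra.smul_def, mul_one, map_div₀, map_one, map_ofNat]
  · simp

theorem delta_inv_pow_smul_X (j : ℕ) :
    (delta⁻¹ ^ j : AffineWeyl) • (RatFunc.X : RatFunc ℂ) = RatFunc.X + (j : RatFunc ℂ) := by
  induction j with
  | zero => simp
  | succ j ih =>
    rw [pow_succ, mul_smul, delta_inv_smul_X, smul_add, ih, smul_one]
    push_cast; ring

/-- The element `a` has no components at `δ⁻ⁱ` for `i > j`. -/
def OrderLE (a : SkewAlg) (j : ℕ) : Prop := ∀ i, j < i → a.coeff (delta⁻¹ ^ i) = 0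

theorem OrderLE.mono {a : SkewAlg} {j k : ℕ} (h : OrderLE a j) (hjk : j ≤ k) : OrderLE a k :=
  fun i hi => h i (hjk.trans_lt hi)

theorem OrderLE.add {a b : SkewAlg} {j : ℕ} (ha : OrderLE a j) (hb : OrderLE b j) :
    OrderLE (a + b) j := fun i hi => by
  rw [SkewMonoidAlgebra.coeff_add, Finsupp.add_apply, ha i hi, hb i hi, add_zero]

theorem OrderLE.fn_mul {a : SkewAlg} {j : ℕ} (ha : OrderLE a j) (r : RatFunc ℂ) :
    OrderLE (fn r * a) j := fun i hi => by
  rw [fn, coeff_single_one_mul, ha i hi, mul_zero]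

theorem coeff_mul_laurent (a : SkewAlg) (b c d : RatFunc ℂ) (j : ℕ) :
    (a * laurent 0 b c d 0).coeff (delta⁻¹ ^ (j + 1)) =
      a.coeff (delta⁻¹ ^ (j + 2)) * (delta⁻¹ ^ (j + 2) : AffineWeyl) • b +
      a.coeff (delta⁻¹ ^ (j + 1)) * (delta⁻¹ ^ (j + 1) : AffineWeyl) • c +
      a.coeff (delta⁻¹ ^ j) * (delta⁻¹ ^ j : AffineWeyl) • d := by
  have h : (delta⁻¹ ^ (j + 1) * (delta⁻¹)⁻¹ : AffineWeyl) = delta⁻¹ ^ j := by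
    rw [pow_succ, mul_inv_cancel_right]
  simp only [laurent, single_zero, zero_add, add_zero, mul_add, SkewMonoidAlgebra.coeff_add, Finsupp.add_apply,
    coeff_mul_single, ← pow_succ, inv_one, mul_one, h]

/-- Right multiplication by a combination of δ, 1, δ⁻¹ never moves a component at δⁿτ to a power of
δ, so the τ-half of the symmetrized element can be ignored. -/
theorem OrderLE.mul_laurent {a : SkewAlg} {j : ℕ} (ha : OrderLE a j) (b c d : RatFunc ℂ) :
    OrderLE (a * laurent 0 b c d 0) (j + 1) := fun i hi => by
  obtain ⟨i, rfl⟩ : ∃ k, i = k + 1 := ⟨i - 1, by omega⟩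
  rw [coeff_mul_laurent, ha _ (by omega), ha _ (by omega), ha _ (by omega)]
  simp

theorem OrderLE.coeff_mul_laurent {a : SkewAlg} {j : ℕ} (ha : OrderLE a j) (b c d : RatFunc ℂ) :
    (a * laurent 0 b c d 0).coeff (delta⁻¹ ^ (j + 1)) =
      a.coeff (delta⁻¹ ^ j) * (delta⁻¹ ^ j : AffineWeyl) • d := by
  rw [KleinianD.coeff_mul_laurent, ha _ (by omega), ha _ (by omega)]
  simp

/-- The leading coefficient of the symmetrized image of `v ^ j`. -/
def leadV (j : ℕ) : RatFunc ℂ := (symIdem * imV q ^ j).coeff (delta⁻¹ ^ j)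

theorem orderLE_symIdem : OrderLE symIdem 0 := fun i hi => by
  rw [coeff_symIdem, if_neg hi.ne']

theorem orderLE_imV_pow (j : ℕ) : OrderLE (symIdem * imV q ^ j) j := by
  induction j with
  | zero => simpa using orderLE_symIdem
  | succ j ih => rw [pow_succ, ← mul_assoc]; exact ih.mul_laurent _ _ _

theorem leadV_succ (j : ℕ) :
    leadV q (j + 1) = leadV q j * (delta⁻¹ ^ j : AffineWeyl) • cMinus q := by
  rw [leadV, pow_succ (imV q), ← mul_assoc]
  exact (orderLE_imV_pow q j).coeff_mul_laurent _ _ _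

theorem orderLE_imV_pow_mul_imW (j : ℕ) : OrderLE (symIdem * (imV q ^ j * imW q)) (j + 1) := by
  rw [← mul_assoc]; exact (orderLE_imV_pow q j).mul_laurent _ _ _

/-- The factor -(x + 1) between the δ⁻¹ coefficients of w and v is shifted by δ⁻ʲ. Its odd part is
what makes the two leading terms of equal degree independent over ℂ[x²]. -/
theorem coeff_imV_pow_mul_imW (j : ℕ) :
    (symIdem * (imV q ^ j * imW q)).coeff (delta⁻¹ ^ (j + 1)) =
      -(RatFunc.X + ((j + 1 : ℕ) : RatFunc ℂ)) * leadV q (j + 1) := by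
  rw [← mul_assoc, imW, (orderLE_imV_pow q j).coeff_mul_laurent, leadV_succ, leadV, smul_mul',
    smul_neg, smul_add, smul_one, delta_inv_pow_smul_X]
  push_cast; ring

variable {q}

theorem cMinus_ne_zero (hq : q ≠ 0) : cMinus q ≠ 0 :=
  div_ne_zero (pol_ne_zero hq) (mul_ne_zero X_ne two_X_add_one_ne)

theorem leadV_ne_zero (hq : q ≠ 0) (j : ℕ) : leadV q j ≠ 0 := by
  induction j with
  | zero =>
    have h := coeff_symIdem 0
    rw [leadV, pow_zero, mul_one, h, if_pos rfl]
    norm_num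
  | succ j ih =>
    rw [leadV_succ]
    exact mul_ne_zero ih ((smul_ne_zero_iff_ne _).2 (cMinus_ne_zero hq))

/-! ### Faithfulness of the symmetrized representation -/

theorem comp_X_sq_eq_zero {P : ℂ[X]} (h : P.comp (X ^ 2) = 0) : P = 0 := by
  rw [← expand_eq_comp_X_pow] at h
  exact (expand_eq_zero two_pos).1 h

/-- Separation of even and odd parts. -/
theorem eq_zero_of_even_add_odd {A B : ℂ[X]} (c : ℂ[X]) (hc : c.comp (-X) = c)
    (h : A.comp (X ^ 2) = (X + c) * B.comp (X ^ 2)) : A = 0 ∧ B = 0 := by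
  have h' := congrArg (fun P => P.comp (-X)) h
  simp only [comp_assoc, mul_comp, add_comp, pow_comp, X_comp, neg_sq, hc] at h'
  have hB : B = 0 := by
    apply comp_X_sq_eq_zero
    have : (C 2 * X) * B.comp (X ^ 2) = 0 := by
      rw [show (C 2 : ℂ[X]) = 2 from rfl]
      linear_combination h' - h
    exact (mul_eq_zero.1 this).resolve_left (mul_ne_zero (C_ne_zero.2 two_ne_zero) X_ne_zero)
  refine ⟨comp_X_sq_eq_zero ?_, hB⟩
  rw [h, hB]; simp

theorem symIdem_mul_toSkew_aeval_mul (P : ℂ[X]) (d : D q) :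
    symIdem * toSkew q (aeval (dGen q .u) P * d) =
      fn (pol (P.comp (X ^ 2))) * (symIdem * toSkew q d) := by
  rw [map_mul, ← mul_assoc, (commute_symIdem_toSkew q _).eq, toSkew_aeval, mul_assoc]

theorem toSkew_v_pow (j : ℕ) : toSkew q (dGen q .v ^ j) = imV q ^ j := by
  rw [map_pow, toSkew_dGen]; rfl

theorem toSkew_v_pow_mul_w (j : ℕ) :
    toSkew q (dGen q .v ^ j * dGen q .w) = imV q ^ j * imW q := by
  rw [map_mul, toSkew_v_pow, toSkew_dGen]; rfl

theorem orderLE_of_mem_filt {j : ℕ} {d : D q} (hd : d ∈ filt q j) :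
    OrderLE (symIdem * toSkew q d) j := by
  induction j generalizing d with
  | zero =>
    obtain ⟨P, rfl⟩ := mem_uSpan.1 hd
    rw [symIdem_mul_toSkew_aeval_mul, map_one, mul_one]
    exact orderLE_symIdem.fn_mul _
  | succ j ih =>
    obtain ⟨d', hd', A, B, rfl⟩ := mem_filt_succ.1 hd
    rw [map_add, map_add, mul_add, mul_add, symIdem_mul_toSkew_aeval_mul,
      symIdem_mul_toSkew_aeval_mul, toSkew_v_pow, toSkew_v_pow_mul_w]
    exact (((ih hd').mono j.le_succ).add ((orderLE_imV_pow q _).fn_mul _)).add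
      ((orderLE_imV_pow_mul_imW q _).fn_mul _)

theorem eq_zero_of_mem_filt (hq : q ≠ 0) {j : ℕ} {d : D q} (hd : d ∈ filt q j)
    (h : symIdem * toSkew q d = 0) : d = 0 := by
  induction j generalizing d with
  | zero =>
    obtain ⟨P, rfl⟩ := mem_uSpan.1 hd
    rw [symIdem_mul_toSkew_aeval_mul, map_one, mul_one] at h
    have h1 := congrArg (fun a => a.coeff (delta⁻¹ ^ 0)) h
    have h0 := coeff_symIdem 0
    simp only [fn, coeff_single_one_mul, h0, if_true, SkewMonoidAlgebra.coeff_zero, Finsupp.coe_zero,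
      Pi.zero_apply] at h1
    have h2 : pol (P.comp (X ^ 2)) = 0 := (mul_eq_zero.1 h1).resolve_right (by norm_num)
    rw [comp_X_sq_eq_zero (by_contra fun hP => pol_ne_zero hP h2)]
    simp
  | succ j ih =>
    obtain ⟨d', hd', A, B, rfl⟩ := mem_filt_succ.1 hd
    have h1 := congrArg (fun a => a.coeff (delta⁻¹ ^ (j + 1))) h
    rw [map_add, map_add, mul_add, mul_add, symIdem_mul_toSkew_aeval_mul,
      symIdem_mul_toSkew_aeval_mul, toSkew_v_pow, toSkew_v_pow_mul_w] at h1
    simp only [SkewMonoidAlgebra.coeff_add, Finsupp.add_apply, fn, coeff_single_one_mul, coeff_imV_pow_mul_imW,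
      orderLE_of_mem_filt hd' _ j.lt_succ_self, SkewMonoidAlgebra.coeff_zero, Finsupp.coe_zero, Pi.zero_apply] at h1
    rw [show (symIdem * imV q ^ (j + 1)).coeff (delta⁻¹ ^ (j + 1)) = leadV q (j + 1) from rfl] at h1
    -- The term `d'` does not reach δ⁻⁽ʲ⁺¹⁾, and the common factor `leadV q (j + 1)` cancels.
    have h2 : pol (A.comp (X ^ 2)) - (RatFunc.X + ((j + 1 : ℕ) : RatFunc ℂ)) * pol (B.comp (X ^ 2)) = 0 := by
      refine (mul_eq_zero.1 ?_).resolve_right (leadV_ne_zero hq (j + 1))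
      rw [← h1]; ring
    have h3 : A.comp (X ^ 2) = (X + ((j + 1 : ℕ) : ℂ[X])) * B.comp (X ^ 2) := by
      apply RatFunc.algebraMap_injective ℂ
      rw [map_mul, map_add, map_natCast, RatFunc.algebraMap_X]
      exact sub_eq_zero.1 h2
    obtain ⟨rfl, rfl⟩ := eq_zero_of_even_add_odd _ (natCast_comp ..) h3
    simp only [map_zero, zero_mul, add_zero] at h ⊢
    exact ih hd' h

theorem eq_zero_of_symIdem_mul (hq : q ≠ 0) {d : D q} (h : symIdem * toSkew q d = 0) : d = 0 := by
  obtain ⟨j, hj⟩ := exists_mem_filt d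
  exact eq_zero_of_mem_filt hq hj h
/-! ### Matrix units -/

section MatrixUnits

variable {R A B ι : Type*} [CommSemiring R] [Ring A] [Algebra R A] [Ring B] [Algebra R B]
  [Fintype ι] [DecidableEq ι]

/-- A homomorphism `φ : B → A` commuting with an idempotent `e` which is the first of a family of
matrix units `r i * l j` extends to a homomorphism from the matrix algebra of `B`. -/
def matrixHom (φ : B →ₐ[R] A) (e : A) (r l : ι → A) (he : ∀ b, Commute e (φ b))
    (hlr : ∀ i j, l i * r j = if i = j then e else 0) (hel : ∀ j, e * l j = l j)
    (hsum : ∑ i, r i * l i = 1) : Matrix ι ι B →ₐ[R] A :=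
  AlgHom.ofLinearMap
    { toFun M := ∑ i, ∑ j, r i * φ (M i j) * l j
      map_add' M N := by
        simp only [Matrix.add_apply, map_add, mul_add, add_mul, Finset.sum_add_distrib]
      map_smul' c M := by
        simp only [Matrix.smul_apply, map_smul, mul_smul_comm, smul_mul_assoc, Finset.smul_sum,
          RingHom.id_apply] }
    (by
      change ∑ i, ∑ j, r i * φ ((1 : Matrix ι ι B) i j) * l j = 1
      rw [← hsum]
      refine Finset.sum_congr rfl fun i _ => ?_
      rw [Finset.sum_eq_single i]
      · simp
      · intro j _ hj; simp [Matrix.one_apply_ne hj.symm]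
      · simp)
    (fun M N => by
      change ∑ i, ∑ j, r i * φ ((M * N) i j) * l j =
        (∑ i, ∑ j, r i * φ (M i j) * l j) * ∑ i, ∑ j, r i * φ (N i j) * l j
      rw [Finset.sum_mul]
      refine Finset.sum_congr rfl fun i _ => ?_
      have key (k k' j : ι) : r i * φ (M i k) * l k * (r k' * φ (N k' j) * l j) =
          if k = k' then r i * φ (M i k * N k' j) * l j else 0 := by
        rw [show r i * φ (M i k) * l k * (r k' * φ (N k' j) * l j) =
          r i * φ (M i k) * (l k * r k') * φ (N k' j) * l j by simp only [mul_assoc], hlr]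
        split_ifs with h
        · rw [mul_assoc _ e, (he _).eq, ← mul_assoc, mul_assoc _ e, hel, map_mul]
          simp only [mul_assoc]
        · simp
      simp only [Finset.sum_mul, Finset.mul_sum, key, Matrix.mul_apply, _root_.map_sum]
      simp only [Finset.sum_ite_eq', Finset.mem_univ, if_true]
      exact Finset.sum_comm)

variable {φ : B →ₐ[R] A} {e : A} {r l : ι → A} {he : ∀ b, Commute e (φ b)}
  {hlr : ∀ i j, l i * r j = if i = j then e else 0} {hel : ∀ j, e * l j = l j}
  {hsum : ∑ i, r i * l i = 1}

theorem matrixHom_apply (M : Matrix ι ι B) :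
    matrixHom φ e r l he hlr hel hsum M = ∑ i, ∑ j, r i * φ (M i j) * l j := rfl

theorem matrixHom_single (i j : ι) (b : B) :
    matrixHom φ e r l he hlr hel hsum (Matrix.single i j b) = r i * φ b * l j := by
  rw [matrixHom_apply, Finset.sum_eq_single i, Finset.sum_eq_single j]
  · simp
  · intro k _ hk; simp [Matrix.single, hk.symm]
  · simp
  · intro k _ hk; simp [Matrix.single, hk.symm]
  · simp

/-- Sandwiching recovers each entry inside the corner, which reduces injectivity to b ↦ eφ(b). -/
theorem mul_matrixHom_mul (hee : e * e = e) (M : Matrix ι ι B) (i j : ι) :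
    l i * matrixHom φ e r l he hlr hel hsum M * r j = e * φ (M i j) := by
  have key (k m : ι) : l i * (r k * φ (M k m) * l m) * r j =
      (l i * r k) * φ (M k m) * (l m * r j) := by simp only [mul_assoc]
  rw [matrixHom_apply]
  simp only [Finset.mul_sum, Finset.sum_mul, key, hlr]
  rw [Finset.sum_eq_single i, Finset.sum_eq_single j]
  · rw [if_pos rfl, if_pos rfl, mul_assoc, ← (he _).eq, ← mul_assoc, hee]
  · intro k _ hk; simp [hk]
  · simp
  · intro k _ hk; simp [hk.symm]
  · simp

theorem matrixHom_injective (hee : e * e = e) (hinj : ∀ b, e * φ b = 0 → b = 0) :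
    Function.Injective (matrixHom φ e r l he hlr hel hsum) := by
  rw [injective_iff_map_eq_zero]
  intro M hM
  ext i j
  refine hinj _ ?_
  rw [← mul_matrixHom_mul (he := he) (hlr := hlr) (hel := hel) (hsum := hsum) hee, hM]
  simp

end MatrixUnits

/-! ### Matrix units in the skew group algebra -/

theorem skew_neg_mul (a b : SkewAlg) : -a * b = -(a * b) := neg_mul a b

theorem skew_mul_neg (a b : SkewAlg) : a * -b = -(a * b) := mul_neg a b

theorem fn_neg (r : RatFunc ℂ) : fn (-r) = -fn r := map_neg fnHom r

theorem grp_tau_mul_fn (r : RatFunc ℂ) : grp tau * fn r = fn (tau • r) * grp tau :=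
  grp_mul_fn tau r

theorem grp_tau_mul_s₁ : grp tau * s₁ = s₁ := by
  rw [s₁, ← mul_assoc, grp_tau_mul_fn, smul_div_fn, smul_mul', smul_two_fn, tau_smul_X, smul_one,
    mul_assoc, mul_sub, grp_tau_mul_grp_tau, mul_one, mul_neg, div_neg,
    fn_neg, skew_neg_mul, ← skew_mul_neg, neg_sub]

theorem symIdem_mul_s₁ : symIdem * s₁ = s₁ := by
  rw [symIdem, smul_mul_assoc, add_mul, grp_tau_mul_s₁, one_mul, ← two_smul ℂ, smul_smul]
  norm_num

theorem s₁_mul_symIdem : s₁ * symIdem = 0 := by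
  rw [s₁, mul_assoc, sub_mul, grp_tau_mul_symIdem, one_mul, sub_self, mul_zero]

theorem symIdem_mul_X_mul_symIdem : symIdem * (fn RatFunc.X * symIdem) = 0 := by
  nth_rw 1 [symIdem]
  rw [smul_mul_assoc, add_mul, ← mul_assoc (grp tau), grp_tau_mul_fn, tau_smul_X, mul_assoc,
    grp_tau_mul_symIdem, one_mul, fn_neg, skew_neg_mul, add_neg_cancel, smul_zero]

theorem s₁_mul_X_mul_symIdem : s₁ * (fn RatFunc.X * symIdem) = symIdem := by
  rw [s₁, mul_assoc, sub_mul, ← mul_assoc (grp tau), grp_tau_mul_fn, tau_smul_X,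
    mul_assoc (fn (-_)), grp_tau_mul_symIdem, one_mul,
    fn_neg, skew_neg_mul, sub_neg_eq_add,
    ← add_mul, ← fn_add, ← mul_assoc, ← fn_mul, ← two_mul,
    one_div_mul_cancel (mul_ne_zero two_ne_zero X_ne), fn_one, one_mul]

/-- Since xs₁ = (1 - τ)/2, this is the splitting into even and odd parts. -/
theorem symIdem_add_X_mul_s₁ : symIdem + fn RatFunc.X * s₁ = 1 := by
  have h : fn RatFunc.X * s₁ = (1 / 2 : ℂ) • (1 - grp tau) := by
    have h1 := X_ne
    rw [smul_eq_fn_mul, s₁, ← mul_assoc, ← fn_mul, map_div₀, map_one, map_ofNat]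
    congr 2
    field_simp
  rw [h, symIdem, ← smul_add, add_add_sub_cancel, ← two_smul ℂ, smul_smul]
  norm_num

/-- The left halves of the matrix units. -/
def rowUnit : Fin 2 → SkewAlg := ![symIdem, fn RatFunc.X * symIdem]

/-- The right halves of the matrix units. -/
def colUnit : Fin 2 → SkewAlg := ![symIdem, s₁]

theorem colUnit_mul_rowUnit (i j : Fin 2) :
    colUnit i * rowUnit j = if i = j then symIdem else 0 := by
  fin_cases i <;> fin_cases j <;>
    simp [colUnit, rowUnit, symIdem_mul_symIdem, s₁_mul_symIdem, symIdem_mul_X_mul_symIdem,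
      s₁_mul_X_mul_symIdem]

theorem symIdem_mul_colUnit (j : Fin 2) : symIdem * colUnit j = colUnit j := by
  fin_cases j <;> simp [colUnit, symIdem_mul_symIdem, symIdem_mul_s₁]

theorem sum_rowUnit_mul_colUnit : ∑ i, rowUnit i * colUnit i = 1 := by
  simp [Fin.sum_univ_two, rowUnit, colUnit, symIdem_mul_symIdem, mul_assoc, symIdem_mul_s₁,
    symIdem_add_X_mul_s₁]

/-- The realization of the `2 × 2` matrix algebra of `D(q)` in the skew group algebra. -/
def matrixToSkew (q : ℂ[X]) : Matrix (Fin 2) (Fin 2) (D q) →ₐ[ℂ] SkewAlg :=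
  matrixHom (toSkew q) symIdem rowUnit colUnit (commute_symIdem_toSkew q) colUnit_mul_rowUnit
    symIdem_mul_colUnit sum_rowUnit_mul_colUnit

theorem matrixToSkew_injective {q : ℂ[X]} (hq : q ≠ 0) : Function.Injective (matrixToSkew q) :=
  matrixHom_injective symIdem_mul_symIdem fun _ => eq_zero_of_symIdem_mul hq

/-! ### The range is `F(q)` -/

variable (q : ℂ[X])

theorem rowUnit_mul_toSkew_mul_colUnit_mem (i j : Fin 2) (d : D q) :
    rowUnit i * toSkew q d * colUnit j ∈ (matrixToSkew q).range :=
  ⟨Matrix.single i j d, matrixHom_single i j d⟩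

theorem toSkew_mul_symIdem_mem (d : D q) : toSkew q d * symIdem ∈ (matrixToSkew q).range := by
  have h := rowUnit_mul_toSkew_mul_colUnit_mem q 0 0 d
  rwa [show rowUnit 0 = symIdem from rfl, show colUnit 0 = symIdem from rfl,
    (commute_symIdem_toSkew q d).eq, mul_assoc, symIdem_mul_symIdem] at h

theorem s₁_mem_range : s₁ ∈ (matrixToSkew q).range := by
  have h := rowUnit_mul_toSkew_mul_colUnit_mem q 0 1 1
  rwa [show rowUnit 0 = symIdem from rfl, show colUnit 1 = s₁ from rfl, map_one, mul_one,
    symIdem_mul_s₁] at h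

/-- As x = xe + x²s₁, it is the image of the matrix with rows (0, u) and (1, 0). -/
theorem fn_X_mem_range : fn RatFunc.X ∈ (matrixToSkew q).range := by
  have h1 := rowUnit_mul_toSkew_mul_colUnit_mem q 1 0 1
  have h2 := rowUnit_mul_toSkew_mul_colUnit_mem q 0 1 (dGen q .u)
  rw [show rowUnit 1 = fn RatFunc.X * symIdem from rfl, show colUnit 0 = symIdem from rfl, map_one,
    mul_one, mul_assoc, symIdem_mul_symIdem] at h1
  rw [show rowUnit 0 = symIdem from rfl, show colUnit 1 = s₁ from rfl,
    (commute_symIdem_toSkew q _).eq, mul_assoc, symIdem_mul_s₁, toSkew_dGen, imGen, sq, fn_mul,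
    mul_assoc] at h2
  have h := add_mem h1 h2
  rwa [← mul_add, symIdem_add_X_mul_s₁, mul_one] at h

theorem fn_pol_mem {S : Subalgebra ℂ SkewAlg} (hS : fn RatFunc.X ∈ S) (P : ℂ[X]) :
    fn (pol P) ∈ S := by
  have h : fn (pol P) = aeval (fn RatFunc.X) P := by
    change fnHom (pol P) = aeval (fnHom RatFunc.X) P
    rw [aeval_algHom_apply, ← pol_X, aeval_algebraMap_apply, aeval_X_left_apply]
  rw [h]
  exact Algebra.adjoin_le (Set.singleton_subset_iff.2 hS) (aeval_mem_adjoin_singleton ℂ _)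

/-- The generator `q(x) s₀`. -/
def qs₀ : SkewAlg := fn (pol q) * s₀

/-- This splits q/(2x + 1) into a polynomial and the polar part (ρ/2)/(2x + 1), which `cZero`
supplies. -/
theorem exists_eq_eval_add : ∃ g : ℂ[X], q = C (q.eval (-1 / 2)) + (2 * X + 1) * g := by
  obtain ⟨g, hg⟩ := X_sub_C_dvd_sub_C_eval (a := (-1 / 2 : ℂ)) (p := q)
  refine ⟨C (1 / 2) * g, ?_⟩
  rw [sub_eq_iff_eq_add] at hg
  nth_rw 1 [hg]
  have h : (2 * X + 1 : ℂ[X]) * C (1 / 2) = X - C (-1 / 2) := by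
    rw [add_mul, show (2 : ℂ[X]) = C 2 from rfl, mul_right_comm, ← C_mul, one_mul, sub_eq_add_neg,
      ← C_neg]
    norm_num
  rw [← mul_assoc, h, add_comm]

/-- The expression of `q(x) s₀` on symmetric elements through the image of `D(q)`. -/
theorem qs₀_mul_symIdem {g : ℂ[X]} (hg : q = C (q.eval (-1 / 2)) + (2 * X + 1) * g) :
    qs₀ q * symIdem =
      ((1 / 2 : ℂ) • (imV q + imW q - fn RatFunc.X * imV q) + fn (pol g)) * symIdem := by
  have h1 : qs₀ q * symIdem = laurent 0 0 (pol q / (2 * RatFunc.X + 1))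
      (-(pol q / (2 * RatFunc.X + 1))) 0 * symIdem := by
    -- On the right, e absorbs τ, so only components at 1 and δ⁻¹ remain.
    rw [qs₀, s₀, ← mul_assoc, ← fn_mul, mul_one_div, mul_assoc, sub_mul, ← grp_mul, mul_assoc (grp _),
      grp_tau_mul_symIdem, one_mul]
    nth_rw 1 [← one_mul symIdem]
    rw [← sub_mul, ← mul_assoc]
    congr 1
    rw [mul_sub, mul_one, fn, grp, single_mul_single, laurent, one_mul, one_smul, mul_one,
      single_neg, single_zero, single_zero, single_zero]
    abel
  rw [h1]
  congr 1
  have hq : pol q = algebraMap ℂ _ (rho q) / 2 + (2 * RatFunc.X + 1) * pol g := by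
    nth_rw 1 [hg]
    rw [pol, map_add, map_mul, map_add, map_mul, map_ofNat, map_one, RatFunc.algebraMap_X, rho]
    congr 1
    rw [map_mul, map_ofNat, mul_div_cancel_left₀ _ two_ne_zero]
    rfl
  rw [smul_eq_fn_mul, fn_eq_laurent (pol g), imV, imW]
  simp only [fn_mul_laurent, laurent_add, laurent_sub]
  have h2 : algebraMap ℂ (RatFunc ℂ) (1 / 2) = 1 / 2 := by
    rw [map_div₀, map_one, map_ofNat]
  rw [h2]
  have h3 := two_X_add_one_ne
  -- In v + w - xv the δ coefficient cancels, since 1 + (x - 1) - x = 0; at δ⁻¹ the factor is 1 - (x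
  -- + 1) - x = -2x.
  congr 1
  · ring
  · ring
  · have hc := cZero_mul q
    apply mul_right_cancel₀ (mul_ne_zero two_X_sub_one_ne h3)
    rw [show pol q / (2 * RatFunc.X + 1) * ((2 * RatFunc.X - 1) * (2 * RatFunc.X + 1)) =
      pol q * (2 * RatFunc.X - 1) by field_simp, hq]
    linear_combination ((2 * RatFunc.X - 1) / 4) * hc
  · rw [cMinus]
    have h4 := X_ne
    field_simp
    ring
  · ring

theorem qs₀_mul_X : qs₀ q * fn RatFunc.X =
    -(fn (RatFunc.X + 1) * qs₀ q) + fn (pol q) := by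
  have h : s₀ * fn RatFunc.X = -(fn (RatFunc.X + 1) * s₀) + 1 := by
    have h1 : (delta⁻¹ * tau) • (RatFunc.X : RatFunc ℂ) = -(RatFunc.X + 1) := by
      rw [mul_smul, tau_smul_X, smul_neg, delta_inv_smul_X]
    have h3 := two_X_add_one_ne
    rw [s₀, mul_assoc, sub_mul, grp_mul_fn, h1, one_mul, ← mul_assoc, ← fn_mul]
    have h4 : (1 : SkewAlg) = fn (1 / (2 * RatFunc.X + 1)) * fn (2 * RatFunc.X + 1) := by
      rw [← fn_mul, one_div_mul_cancel h3, fn_one]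
    rw [mul_comm (RatFunc.X + 1), fn_mul, mul_assoc, ← skew_mul_neg]
    refine Eq.trans ?_ (congrArg (_ + ·) h4.symm)
    rw [← mul_add]
    congr 1
    rw [fn_neg, show (2 * RatFunc.X + 1 : RatFunc ℂ) = RatFunc.X + (RatFunc.X + 1) by ring,
      fn_add RatFunc.X (RatFunc.X + 1), skew_neg_mul, mul_sub, mul_one]
    abel
  rw [qs₀, mul_assoc, h, mul_add, mul_one, skew_mul_neg, ← mul_assoc, ← mul_assoc, ← fn_mul, ← fn_mul,
    mul_comm (pol q)]

theorem qs₀_mem_range : qs₀ q ∈ (matrixToSkew q).range := by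
  have hx := fn_X_mem_range q
  have hs := s₁_mem_range q
  have he : symIdem ∈ (matrixToSkew q).range := by simpa using toSkew_mul_symIdem_mem q 1
  have hv : imV q * symIdem ∈ (matrixToSkew q).range := by
    simpa [toSkew_dGen, imGen] using toSkew_mul_symIdem_mem q (dGen q .v)
  have hw : imW q * symIdem ∈ (matrixToSkew q).range := by
    simpa [toSkew_dGen, imGen] using toSkew_mul_symIdem_mem q (dGen q .w)
  have hTe : qs₀ q * symIdem ∈ (matrixToSkew q).range := by
    obtain ⟨g, hg⟩ := exists_eq_eval_add q
    rw [qs₀_mul_symIdem q hg, add_mul, smul_mul_assoc, sub_mul, add_mul, mul_assoc (fn _)]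
    exact add_mem (Subalgebra.smul_mem _ (sub_mem (add_mem hv hw) (mul_mem hx hv)) _)
      (mul_mem (fn_pol_mem hx g) he)
  -- With T = `qs₀ q`, T = T(e + xs₁) = Te + (Txe)s₁, and the twisted Leibniz rule `qs₀_mul_X` turns
  -- Txe into -(x + 1)Te + q(x)e.
  have h : qs₀ q = qs₀ q * symIdem +
      (-(fn (RatFunc.X + 1) * (qs₀ q * symIdem)) + fn (pol q) * symIdem) * s₁ := by
    have h1 : -(fn (RatFunc.X + 1) * (qs₀ q * symIdem)) + fn (pol q) * symIdem =
        qs₀ q * fn RatFunc.X * symIdem := by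
      rw [qs₀_mul_X, add_mul, skew_neg_mul, mul_assoc]
    rw [h1, mul_assoc _ symIdem, symIdem_mul_s₁, mul_assoc, ← mul_add, symIdem_add_X_mul_s₁,
      mul_one]
  rw [h]
  refine add_mem hTe (mul_mem (add_mem (neg_mem (mul_mem ?_ hTe)) (mul_mem (fn_pol_mem hx q) he)) hs)
  rw [fn_add, fn_one]
  exact add_mem hx (one_mem _)

theorem F_le_range : F q ≤ (matrixToSkew q).range := by
  rw [F, Algebra.adjoin_le_iff]
  rintro _ (rfl | rfl | rfl)
  · exact qs₀_mem_range q
  · exact s₁_mem_range q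
  · exact fn_X_mem_range q

/-! ### The range is contained in F(q) -/

theorem qs₀_mem_F : qs₀ q ∈ F q := Algebra.subset_adjoin (Or.inl rfl)

theorem s₁_mem_F : s₁ ∈ F q := Algebra.subset_adjoin (Or.inr (Or.inl rfl))

theorem fn_X_mem_F : fn RatFunc.X ∈ F q := Algebra.subset_adjoin (Or.inr (Or.inr rfl))

theorem symIdem_mem_F : symIdem ∈ F q := by
  rw [eq_sub_of_add_eq symIdem_add_X_mul_s₁]
  exact sub_mem (one_mem _) (mul_mem (fn_X_mem_F q) (s₁_mem_F q))

/-- Left multiplication of (v + w - xv)e by s₁ isolates v: s₁ kills ve = ev and we = ew, while s₁xev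
= ev. -/
theorem imV_mul_symIdem_mem_F : imV q * symIdem ∈ F q := by
  obtain ⟨g, hg⟩ := exists_eq_eval_add q
  have hv : symIdem * imV q = imV q * symIdem :=
    symIdem_mul_of_commute (commute_tau_imGen q .v)
  have hw : symIdem * imW q = imW q * symIdem :=
    symIdem_mul_of_commute (commute_tau_imGen q .w)
  have h : imV q * symIdem =
      (-2 : ℂ) • (s₁ * (qs₀ q * symIdem - fn (pol g) * symIdem)) := by
    rw [qs₀_mul_symIdem q hg, add_mul, add_sub_cancel_right, smul_mul_assoc, mul_smul_comm,
      smul_smul, sub_mul, add_mul, mul_assoc (fn _), ← hv, ← hw, mul_sub, mul_add, ← mul_assoc,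
      ← mul_assoc s₁ symIdem, s₁_mul_symIdem, ← mul_assoc (fn _), ← mul_assoc,
      s₁_mul_X_mul_symIdem]
    norm_num
  rw [h]
  exact Subalgebra.smul_mem _ (mul_mem (s₁_mem_F q) (sub_mem (mul_mem (qs₀_mem_F q)
    (symIdem_mem_F q)) (mul_mem (fn_pol_mem (fn_X_mem_F q) g) (symIdem_mem_F q)))) _

theorem imW_mul_symIdem_mem_F : imW q * symIdem ∈ F q := by
  obtain ⟨g, hg⟩ := exists_eq_eval_add q
  have h : imW q * symIdem = (2 : ℂ) • (qs₀ q * symIdem - fn (pol g) * symIdem) +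
      fn RatFunc.X * (imV q * symIdem) - imV q * symIdem := by
    rw [qs₀_mul_symIdem q hg, add_mul, add_sub_cancel_right, smul_mul_assoc,
      smul_smul, sub_mul, add_mul, mul_assoc (fn _)]
    norm_num
  rw [h]
  have hv := imV_mul_symIdem_mem_F q
  exact sub_mem (add_mem (Subalgebra.smul_mem _ (sub_mem (mul_mem (qs₀_mem_F q)
    (symIdem_mem_F q)) (mul_mem (fn_pol_mem (fn_X_mem_F q) g) (symIdem_mem_F q))) _)
    (mul_mem (fn_X_mem_F q) hv)) hv

theorem toSkew_mul_symIdem_mem_F (d : D q) : toSkew q d * symIdem ∈ F q := by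
  have hd : d ∈ Algebra.adjoin ℂ (Set.range (dGen q)) := adjoin_dGen q ▸ Algebra.mem_top
  induction hd using Algebra.adjoin_induction with
  | mem x hx =>
    obtain ⟨g, rfl⟩ := hx
    rw [toSkew_dGen]
    cases g with
    | u =>
      refine mul_mem ?_ (symIdem_mem_F q)
      rw [imGen, sq, fn_mul]
      exact mul_mem (fn_X_mem_F q) (fn_X_mem_F q)
    | v => exact imV_mul_symIdem_mem_F q
    | w => exact imW_mul_symIdem_mem_F q
  | algebraMap r =>
    rw [AlgHom.commutes]
    exact mul_mem (Subalgebra.algebraMap_mem _ r) (symIdem_mem_F q)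
  | add x y _ _ hx hy => rw [map_add, add_mul]; exact add_mem hx hy
  | mul x y _ _ hx hy =>
    -- Because e is idempotent and commutes with the image, φ(xy)e = (φ(x)e)(φ(y)e).
    rw [map_mul, mul_assoc, ← symIdem_mul_symIdem, ← mul_assoc (toSkew q y),
      ← (commute_symIdem_toSkew q y).eq, mul_assoc symIdem, ← mul_assoc]
    exact mul_mem hx hy

theorem range_matrixToSkew : (matrixToSkew q).range = F q := by
  refine le_antisymm ?_ (F_le_range q)
  rintro _ ⟨M, rfl⟩
  change matrixHom _ _ _ _ _ _ _ _ M ∈ F q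
  rw [matrixHom_apply]
  refine sum_mem fun i _ => sum_mem fun j _ => mul_mem ?_ ?_
  · have h : rowUnit i * symIdem = rowUnit i := by
      fin_cases i <;> simp [rowUnit, mul_assoc, symIdem_mul_symIdem]
    rw [← h, mul_assoc, (commute_symIdem_toSkew q _).eq]
    refine mul_mem ?_ (toSkew_mul_symIdem_mem_F q _)
    fin_cases i
    · exact symIdem_mem_F q
    · exact mul_mem (fn_X_mem_F q) (symIdem_mem_F q)
  · fin_cases j
    · exact symIdem_mem_F q
    · exact s₁_mem_F q

/-- `F(q)` is the `2 × 2` matrix algebra over `D(q)`. -/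
def matrixEquivF {q : ℂ[X]} (hq : q ≠ 0) : Matrix (Fin 2) (Fin 2) (D q) ≃ₐ[ℂ] F q :=
  (AlgEquiv.ofInjective (matrixToSkew q) (matrixToSkew_injective hq)).trans
    (Subalgebra.equivOfEq _ _ (range_matrixToSkew q))

end

end KleinianD

theorem theorem1p2 (q : Polynomial ℂ) (hq : 4 ≤ q.natDegree) :
    IsMoritaEquivalent ℂ (KleinianD.D q) (KleinianD.F q) := by
  have hq0 : q ≠ 0 := by
    rintro rfl
    simp at hq
  exact (IsMoritaEquivalent.matrix (KleinianD.D q) (ι := Fin 2) ℂ).trans ℂ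
    (.of_algEquiv ℂ (KleinianD.matrixEquivF hq0))
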